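/- Let $d\ge 1$, let $(\Omega,\mathcal F,\mathbb P)$ be a probability space, and let $(\mathbb R^d,+)$ act on $\Omega$ by bijections $\tau_x$, $x\in\mathbb R^d$, such that $(x,\omega)\mapsto\tau_x\omega$ is product measurable and every $\tau_x$ preserves $\mathbb P$ (ergodicity is not assumed). For a function $f$ on $\Omega$ write $f_\omega(x):=f(\tau_x\omega)$, and write $L^2$ for the space of measurable square integrable functions on $\Omega$. A measurable function $f$ has the weak derivative $\partial_i f=g$, with $g$ measurable on $\Omega$, if for $\mathbb P$-a.e. $\omega$ the functions $f_\omega$ and $g_\omega$ are locally integrable on $\mathbb R^d$ and $g_\omega$ is the $i$-th weak partial derivative of $f_\omega$ on $\mathbb R^d$. If $f_\omega$ is smooth for every $\omega$, let $D^nf(\omega):=D^nf_\omega(0)$ and let $\partial_i f(\omega):=\partial_i f_\omega(0)$ (the classical derivative, which agrees with the weak one a.s.). Put $$\mathbb D_w:=\{f\in L^2:\ \partial_i f\text{ exists weakly and } \partial_i f\in L^2\text{ for } i=1,\dots,d\},\qquad \|f\|_\nabla:=\|f\|_2+\sum_{i=1}^d\|\partial_i f\|_2,$$ $$\mathbb D_s:=\{f\in\mathbb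 D_w:\ f_\omega\in C^\infty(\mathbb R^d)\ \forall\omega\in\Omega,\ \sup_\Omega|D^nf|<\infty\ \forall n\in\mathbb N_0\},$$ $$\mathbb F_w:=\{f\in\mathbb D_w:\ \mathbb E f=1,\ \exists c>0:\ f>c\ \mathbb P\text{-a.s.},\ \|f\|_\infty<\infty,\ \|\nabla f\|_\infty<\infty\},$$ $$\mathbb F_s:=\{f\in\mathbb D_s:\ \mathbb E f=1,\ \exists c>0:\ f>c\text{ on }\Omega\},$$ and, for $y\in\mathbb R^d$, $$\Phi_y^w:=\{\phi\in(L^2)^d:\ \mathbb E[\nabla w\cdot\phi]=0\ \forall w\in\mathbb D_s,\ \mathbb E\phi=y\},\qquad \Phi_y^s:=\{\phi\in(\mathbb D_s)^d:\ \nabla\cdot\phi=0\ \forall\omega\in\Omega,\ \mathbb E\phi=y\}.$$ Then: 1. $\mathbb D_s$ is dense in $L^2$. 2. $\mathbb D_s\subset\mathbb D_w$, and $\mathbb D_s$ is dense in $\mathbb D_w$ with respect to $\|\cdot\|_\nabla$. 3. $\mathbb F_s\subset\mathbb F_w$, and for every $f\in\mathbb F_w$ there are a sequence $(f_n)_{n}$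 in $\mathbb F_s$ and a constant $c>0$ such that $\|f_n-f\|_\nabla\to0$ and $\inf_n f_n>c$ $\mathbb P$-a.s. 4. For every $y\in\mathbb R^d$, $\Phi_y^s\subset\Phi_y^w$, and $\Phi_y^s$ is dense in $\Phi_y^w$ with respect to $\|\cdot\|_2$. -/

import Mathlib

open MeasureTheory Filter Topology
open scoped ENNReal

namespace StationaryDensity

/-- The Euclidean space `ℝ^d`. It acts additively on `Ω`; the shift `τ_x ω` is written `x +ᵥ ω`. -/
abbrev E (d : ℕ) : Type := EuclideanSpace ℝ (Fin d)

/-- The unit vector `e_i`. -/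
noncomputable abbrev e {d : ℕ} (i : Fin d) : E d := EuclideanSpace.single i (1 : ℝ)

variable {d : ℕ} {Ω : Type*} [MeasurableSpace Ω] [AddAction (E d) Ω]

/-- The realisation `f_ω : ℝ^d → ℝ`, `f_ω(x) = f(τ_x ω)`. -/
def realisation (d : ℕ) {Ω : Type*} [AddAction (E d) Ω] (f : Ω → ℝ) (ω : Ω) : E d → ℝ :=
  fun x => f (x +ᵥ ω)

/-- `u` and `v` are locally integrable on `ℝ^d` and `v` is the `i`-th weak partial derivative
of `u`. -/
def IsEuclideanWeakPartial (i : Fin d) (u v : E d → ℝ) : Prop :=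
  LocallyIntegrable u volume ∧ LocallyIntegrable v volume ∧
    ∀ φ : E d → ℝ, ContDiff ℝ (⊤ : ℕ∞) φ → HasCompactSupport φ →
      ∫ x, u x * fderiv ℝ φ x (e i) = - ∫ x, v x * φ x

/-- `g` is an `i`-th weak partial derivative of `f` on `Ω`: it is measurable and, almost surely,
its realisation is the weak partial derivative of the realisation of `f`. -/
def IsWeakPartial (P : Measure Ω) (i : Fin d) (f g : Ω → ℝ) : Prop :=
  Measurable g ∧
    ∀ᵐ ω ∂P, IsEuclideanWeakPartial i (realisation d f ω) (realisation d g ω)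

/-- `f` is weakly differentiable in direction `i`. -/
def WeaklyDifferentiable (P : Measure Ω) (i : Fin d) (f : Ω → ℝ) : Prop :=
  ∃ g, IsWeakPartial P i f g

open Classical in
/-- The weak partial derivative `∂_i f` (a version of it; it is unique almost surely, see
`IsWeakPartial.ae_unique`), and `0` if `f` is not weakly differentiable in direction `i`. -/
noncomputable def weakPartial (P : Measure Ω) (i : Fin d) (f : Ω → ℝ) : Ω → ℝ :=
  if h : WeaklyDifferentiable P i f then h.choose else 0

theorem isWeakPartial_weakPartial {P : Measure Ω} {i : Fin d} {f : Ω → ℝ}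
    (h : WeaklyDifferentiable P i f) : IsWeakPartial P i f (weakPartial P i f) := by
  unfold weakPartial
  rw [dif_pos h]
  exact h.choose_spec

/-- Weak partial derivatives are unique almost surely. -/
theorem IsWeakPartial.ae_unique [MeasurableVAdd₂ (E d) Ω] {P : Measure Ω}
    [IsProbabilityMeasure P] [VAddInvariantMeasure (E d) Ω P] {i : Fin d} {f g h : Ω → ℝ}
    (hg : IsWeakPartial P i f g) (hh : IsWeakPartial P i f h) : g =ᵐ[P] h := by
  have key : ∀ᵐ ω ∂P, ∀ᵐ x : E d, g (x +ᵥ ω) = h (x +ᵥ ω) := by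
    filter_upwards [hg.2, hh.2] with ω h1 h2
    have h3 := ae_eq_of_integral_contDiff_smul_eq h1.2.1 h2.2.1 (fun φ hφ hc => by
      have a := h1.2.2 φ hφ hc
      have b := h2.2.2 φ hφ hc
      have c : ∫ x, realisation d g ω x * φ x = ∫ x, realisation d h ω x * φ x := by linarith
      simpa [smul_eq_mul, mul_comm] using c)
    exact h3
  have hm : MeasurableSet {p : Ω × E d | g (p.2 +ᵥ p.1) = h (p.2 +ᵥ p.1)} :=
    measurableSet_eq_fun (hg.1.comp (measurable_snd.vadd measurable_fst))
      (hh.1.comp (measurable_snd.vadd measurable_fst))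
  have key2 : ∀ᵐ x : E d, ∀ᵐ ω ∂P, g (x +ᵥ ω) = h (x +ᵥ ω) :=
    (Measure.ae_ae_comm (μ := P) (ν := (volume : Measure (E d)))
      (p := fun ω x => g (x +ᵥ ω) = h (x +ᵥ ω)) hm).1 key
  obtain ⟨x, hx⟩ := key2.exists
  have hmp : MeasurePreserving (fun ω : Ω => (-x) +ᵥ ω) P P := measurePreserving_vadd (-x) P
  have := hmp.quasiMeasurePreserving.ae hx
  filter_upwards [this] with ω hω
  simpa using hω

/-- The domain `𝒟(∂_i)`: the functions in `L²` with `i`-th weak derivative in `L²`. -/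
def Dom (P : Measure Ω) (i : Fin d) : Set (Ω → ℝ) :=
  {f | Measurable f ∧ MemLp f 2 P ∧ WeaklyDifferentiable P i f ∧
    MemLp (weakPartial P i f) 2 P}

/-- The graph norm `‖f‖_∇ = ‖f‖₂ + ∑ i, ‖∂_i f‖₂`, as an extended nonnegative number. -/
noncomputable def gradNorm (d : ℕ) {Ω : Type*} [MeasurableSpace Ω] [AddAction (E d) Ω]
    (P : Measure Ω) (f : Ω → ℝ) : ℝ≥0∞ :=
  eLpNorm f 2 P + ∑ i : Fin d, eLpNorm (weakPartial P i f) 2 P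

/-- `𝔻_w`, the intersection of the domains `𝒟(∂_i)` inside `L²`. -/
def Dw (d : ℕ) {Ω : Type*} [MeasurableSpace Ω] [AddAction (E d) Ω] (P : Measure Ω) :
    Set (Ω → ℝ) :=
  {f | Measurable f ∧ MemLp f 2 P ∧ ∀ i : Fin d, f ∈ Dom P i}

/-- `𝔻_s`: all realisations are smooth and `D^n f (ω) = D^n f_ω (0)` is bounded on `Ω` for every
`n`. -/
def Ds (d : ℕ) {Ω : Type*} [MeasurableSpace Ω] [AddAction (E d) Ω] (P : Measure Ω) :
    Set (Ω → ℝ) :=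
  {f | f ∈ Dw d P ∧ (∀ ω, ContDiff ℝ (⊤ : ℕ∞) (realisation d f ω)) ∧
    ∀ n : ℕ, ∃ C : ℝ, ∀ ω, ‖iteratedFDeriv ℝ n (realisation d f ω) 0‖ ≤ C}

/-- The classical partial derivative `∂_i f (ω) = ∂_i f_ω (0)`, used for functions all of whose
realisations are differentiable. -/
noncomputable def classicalPartial (i : Fin d) (f : Ω → ℝ) (ω : Ω) : ℝ :=
  fderiv ℝ (realisation d f ω) 0 (e i)

/-- `𝔽_w`, weakly differentiable probability densities. -/
def Fw (d : ℕ) {Ω : Type*} [MeasurableSpace Ω] [AddAction (E d) Ω] (P : Measure Ω) :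
    Set (Ω → ℝ) :=
  {f | f ∈ Dw d P ∧ ∫ ω, f ω ∂P = 1 ∧ (∃ c : ℝ, 0 < c ∧ ∀ᵐ ω ∂P, c < f ω) ∧
    eLpNorm f ∞ P < ∞ ∧ ∀ i : Fin d, eLpNorm (weakPartial P i f) ∞ P < ∞}

/-- `𝔽_s`, smooth probability densities. -/
def Fs (d : ℕ) {Ω : Type*} [MeasurableSpace Ω] [AddAction (E d) Ω] (P : Measure Ω) :
    Set (Ω → ℝ) :=
  {f | f ∈ Ds d P ∧ ∫ ω, f ω ∂P = 1 ∧ ∃ c : ℝ, 0 < c ∧ ∀ ω, c < f ω}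

/-- `Φ_y^w`, weakly divergence-free square integrable vector fields with mean `y`. -/
def Phiw (P : Measure Ω) (y : E d) : Set (Ω → E d) :=
  {φ | Measurable φ ∧ MemLp φ 2 P ∧
    (∀ w ∈ Ds d P, ∫ ω, ∑ i : Fin d, classicalPartial i w ω * φ ω i ∂P = 0) ∧
    ∫ ω, φ ω ∂P = y}

/-- `Φ_y^s`, smooth vector fields that are divergence-free at every `ω`, with mean `y`. -/
def Phis (P : Measure Ω) (y : E d) : Set (Ω → E d) :=
  {φ | (∀ i : Fin d, (fun ω => φ ω i) ∈ Ds d P) ∧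
    (∀ ω, ∑ i : Fin d, classicalPartial i (fun ω' => φ ω' i) ω = 0) ∧
    ∫ ω, φ ω ∂P = y}

/-- `𝔇`: subsets of `𝔻_w` that are dense in `𝔻_w` with respect to the graph norm. -/
def frakD (d : ℕ) {Ω : Type*} [MeasurableSpace Ω] [AddAction (E d) Ω] (P : Measure Ω) :
    Set (Set (Ω → ℝ)) :=
  {D | D ⊆ Dw d P ∧ ∀ f ∈ Dw d P, ∀ ε : ℝ≥0∞, 0 < ε → ∃ g ∈ D, gradNorm d P (g - f) < ε}

/-- `𝔉`: the admissible dense classes of densities. -/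
def frakF (d : ℕ) {Ω : Type*} [MeasurableSpace Ω] [AddAction (E d) Ω] (P : Measure Ω) :
    Set (Set (Ω → ℝ)) :=
  {F | F ⊆ Fw d P ∧ ∀ f ∈ Fw d P, ∃ (fn : ℕ → Ω → ℝ) (c : ℝ), (∀ n, fn n ∈ F) ∧ 0 < c ∧
    Tendsto (fun n => gradNorm d P (fn n - f)) atTop (𝓝 0) ∧
    ∀ᵐ ω ∂P, c < ⨅ n, fn n ω}

/-- `𝔓_y`: subsets of `Φ_y^w` that are dense in `Φ_y^w` with respect to the `L²` norm. -/
def frakP (P : Measure Ω) (y : E d) : Set (Set (Ω → E d)) :=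
  {S | S ⊆ Phiw P y ∧
    ∀ φ ∈ Phiw P y, ∀ ε : ℝ≥0∞, 0 < ε → ∃ ψ ∈ S, eLpNorm (ψ - φ) 2 P < ε}

end StationaryDensity

set_option linter.unusedSectionVars false

namespace StationaryDensity

section

variable {d : ℕ} {Ω : Type*} [MeasurableSpace Ω]

/-! ### Convergence in `L²` -/

/-! Everything rests on mollification along orbits, `mollify K f ω = ∫ K(t) f(τ_{-t} ω) dt`, whose
realisations are ordinary convolutions on `ℝ^d` (`realisation_mollify`). For bounded `f` and a test
function `K` it lies in `Ds` (`mollify_mem_Ds`). Invariance of `P` makes it bounded on `L²`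
(`eLpNorm_mollify_le`), and Lebesgue differentiation on almost every orbit, transferred to `Ω` by
Fubini, gives almost sure convergence. Truncation by a scaled arctangent then yields `L²`
convergence and density in `L²`.

Mollification commutes with weak derivatives, so it also converges in the graph norm, but its output
is bounded only if its input is. For density in `Dw` one therefore mollifies, truncates, and
mollifies again; the chain rule is needed only for `C^1` realisations. For densities one starts from
a version bounded above and below everywhere, and mollification keeps these bounds and the mean.

For divergence-free fields, subtract `y` and project orthogonally onto the closure of `Φ_0^s` in
`L²`. The remainder `r` has mean zero and is orthogonal to gradients and to `Φ_0^s`. Testing with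
`∂_j h e_i - ∂_i h e_j` shows that `r` is weakly curl-free, so each component is orthogonal to all
Laplacians. The gradient of a mollified component is then orthogonal to all gradients of `Ds`,
hence, by density in `Dw`, to itself, and each component is constant along orbits
(`ae_ae_eq_of_integral_laplacian_eq_zero`). Without ergodicity such a component need not be constant
on `Ω`; testing with the invariant fields `(g - 𝔼 g) e_i`, where `g` is an invariant version of
`arctan r_i`, forces `r_i = 0`. -/

theorem tendsto_eLpNorm_two_of_dominated {P : Measure Ω} {f : ℕ → Ω → ℝ} {F G : Ω → ℝ}
    (hf : ∀ n, AEStronglyMeasurable (f n) P) (hF : AEStronglyMeasurable F P) (hG : MemLp G 2 P)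
    (hb : ∀ n, ∀ᵐ ω ∂P, |f n ω - F ω| ≤ G ω)
    (hlim : ∀ᵐ ω ∂P, Tendsto (fun n => f n ω) atTop (𝓝 (F ω))) :
    Tendsto (fun n => eLpNorm (f n - F) 2 P) atTop (𝓝 0) := by
  have h2 : (2 : ℝ≥0∞).toReal = 2 := by norm_num
  have key : Tendsto (fun n => ∫⁻ ω, ‖(f n - F) ω‖ₑ ^ (2 : ℝ) ∂P) atTop
      (𝓝 (∫⁻ _, 0 ∂P)) := by
    refine tendsto_lintegral_of_dominated_convergence' (fun ω => ‖G ω‖ₑ ^ (2 : ℝ))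
      (fun n => ((hf n).sub hF).enorm.pow_const _) (fun n => ?_) ?_ ?_
    · filter_upwards [hb n] with ω h
      gcongr
      rw [enorm_le_iff_norm_le]
      exact h.trans (le_abs_self _)
    · have := lintegral_rpow_enorm_lt_top_of_eLpNorm_lt_top (p := 2) (by norm_num) (by norm_num)
        hG.2
      rw [h2] at this
      exact this.ne
    · filter_upwards [hlim] with ω h
      have h3 : Tendsto (fun n => ‖(f n - F) ω‖ₑ) atTop (𝓝 0) := by
        have := (h.sub_const (F ω)).enorm
        simpa using this
      have := (ENNReal.continuous_rpow_const (y := 2)).tendsto 0 |>.comp h3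
      simpa [Function.comp_def] using this
  simp only [lintegral_zero] at key
  have := (ENNReal.continuous_rpow_const (y := 1 / 2)).tendsto 0 |>.comp key
  simp only [Function.comp_def] at this
  rw [ENNReal.zero_rpow_of_pos (by norm_num)] at this
  refine this.congr (fun n => ?_)
  rw [eLpNorm_eq_lintegral_rpow_enorm_toReal (by norm_num) (by norm_num), h2]

/-- The Cauchy–Schwarz inequality. -/
theorem enorm_integral_mul_le {P : Measure Ω} {f g : Ω → ℝ}
    (hf : AEStronglyMeasurable f P) (hg : AEStronglyMeasurable g P) :
    ‖∫ ω, f ω * g ω ∂P‖ₑ ≤ eLpNorm f 2 P * eLpNorm g 2 P := by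
  calc ‖∫ ω, f ω * g ω ∂P‖ₑ ≤ ∫⁻ ω, ‖f ω * g ω‖ₑ ∂P := enorm_integral_le_lintegral_enorm _
    _ = eLpNorm (f • g) 1 P := by rw [eLpNorm_one_eq_lintegral_enorm]; rfl
    _ ≤ _ := eLpNorm_smul_le_mul_eLpNorm hg hf

theorem tendsto_integral_mul {P : Measure Ω} {F g : Ω → ℝ} {fn : ℕ → Ω → ℝ}
    (hfn : ∀ n, MemLp (fn n) 2 P) (hF : MemLp F 2 P) (hg : MemLp g 2 P)
    (h : Tendsto (fun n => eLpNorm (fn n - F) 2 P) atTop (𝓝 0)) :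
    Tendsto (fun n => ∫ ω, g ω * fn n ω ∂P) atTop (𝓝 (∫ ω, g ω * F ω ∂P)) := by
  rw [tendsto_iff_edist_tendsto_0]
  refine tendsto_of_tendsto_of_tendsto_of_le_of_le tendsto_const_nhds
    (h := fun n => eLpNorm g 2 P * eLpNorm (fn n - F) 2 P) ?_ (fun _ => zero_le) ?_
  · simpa using ENNReal.Tendsto.const_mul h (Or.inr hg.2.ne)
  · intro n
    have h1 : Integrable (fun ω => g ω * fn n ω) P := hg.integrable_mul (hfn n)
    have h2 : Integrable (fun ω => g ω * F ω) P := hg.integrable_mul hF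
    simp only [edist_eq_enorm_sub]
    rw [← integral_sub h1 h2]
    refine le_trans (le_of_eq ?_) (enorm_integral_mul_le hg.1 ((hfn n).sub hF).1)
    congr 2 with ω
    simp [mul_sub]

/-! ### The action on `Ω` -/

section Action

variable [AddAction (E d) Ω] [MeasurableVAdd₂ (E d) Ω]

theorem measurable_realisation_uncurry {f : Ω → ℝ} (hf : Measurable f) :
    Measurable (fun p : Ω × E d => realisation d f p.1 p.2) :=
  hf.comp (measurable_snd.vadd measurable_fst)

theorem measurable_realisation {f : Ω → ℝ} (hf : Measurable f) (ω : Ω) :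
    Measurable (realisation d f ω) :=
  (measurable_realisation_uncurry hf).comp (measurable_const.prodMk measurable_id)

variable {P : Measure Ω} [IsProbabilityMeasure P] [VAddInvariantMeasure (E d) Ω P]

theorem ae_vadd {p : Ω → Prop} (h : ∀ᵐ ω ∂P, p ω) (x : E d) : ∀ᵐ ω ∂P, p (x +ᵥ ω) :=
  (measurePreserving_vadd x P).quasiMeasurePreserving.ae h

/-- An almost sure property holds along almost every point of almost every orbit. -/
theorem ae_ae_vadd {p : Ω → Prop} (h : ∀ᵐ ω ∂P, p ω) :
    ∀ᵐ ω ∂P, ∀ᵐ x : E d, p (x +ᵥ ω) := by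
  -- `p` need not be measurable; Fubini is applied to a measurable null superset of its exceptional
  -- set.
  obtain ⟨t, ht, htm, ht0⟩ := exists_measurable_superset_of_null (ae_iff.1 h)
  have hm : MeasurableSet {q : Ω × E d | q.2 +ᵥ q.1 ∉ t} :=
    (measurable_snd.vadd measurable_fst) htm.compl
  have h1 : ∀ᵐ x : E d, ∀ᵐ ω ∂P, x +ᵥ ω ∉ t :=
    Eventually.of_forall fun x => ae_vadd (measure_eq_zero_iff_ae_notMem.1 ht0) x
  have h2 := (Measure.ae_ae_comm (μ := P) (ν := (volume : Measure (E d)))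
      (p := fun ω x => x +ᵥ ω ∉ t) hm).2 h1
  filter_upwards [h2] with ω hω
  filter_upwards [hω] with x hx
  by_contra hp
  exact hx (ht hp)

/-- By Fubini some single shift `x` satisfies `p (x +ᵥ ω)` for almost every `ω`; shifting back by
`-x` preserves null sets. -/
theorem ae_of_ae_ae_vadd {p : Ω → Prop} (hp : MeasurableSet {ω | p ω})
    (h : ∀ᵐ ω ∂P, ∀ᵐ x : E d, p (x +ᵥ ω)) : ∀ᵐ ω ∂P, p ω := by
  have hm : MeasurableSet {q : Ω × E d | p (q.2 +ᵥ q.1)} :=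
    (measurable_snd.vadd measurable_fst) hp
  have h2 := (Measure.ae_ae_comm (μ := P) (ν := (volume : Measure (E d)))
      (p := fun ω x => p (x +ᵥ ω)) hm).1 h
  obtain ⟨x, hx⟩ := h2.exists
  simpa using ae_vadd hx (-x)

theorem lintegral_vadd {f : Ω → ℝ≥0∞} (hf : Measurable f) (x : E d) :
    ∫⁻ ω, f (x +ᵥ ω) ∂P = ∫⁻ ω, f ω ∂P :=
  (measurePreserving_vadd x P).lintegral_comp hf

theorem ae_realisation_eq {f g : Ω → ℝ} (h : f =ᵐ[P] g) :
    ∀ᵐ ω ∂P, realisation d f ω =ᵐ[volume] realisation d g ω :=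
  ae_ae_vadd h

/-- Almost every realisation of an integrable function is locally integrable. -/
theorem ae_locallyIntegrable_realisation {f : Ω → ℝ} (hf : Measurable f) (hi : Integrable f P) :
    ∀ᵐ ω ∂P, LocallyIntegrable (realisation d f ω) volume := by
  have h1 : ∀ n : ℕ, ∀ᵐ ω ∂P,
      ∫⁻ x in Metric.closedBall (0 : E d) n, ‖realisation d f ω x‖ₑ < ∞ := by
    intro n
    have hm := (measurable_realisation_uncurry (d := d) hf).enorm
    refine ae_lt_top hm.lintegral_prod_right' (ne_of_lt ?_)
    rw [lintegral_lintegral_swap hm.aemeasurable]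
    have : ∀ x : E d, ∫⁻ ω, ‖realisation d f ω x‖ₑ ∂P = ∫⁻ ω, ‖f ω‖ₑ ∂P :=
      fun x => lintegral_vadd hf.enorm x
    simp only [this, lintegral_const, Measure.restrict_apply MeasurableSet.univ, Set.univ_inter]
    exact ENNReal.mul_lt_top hi.2 (isCompact_closedBall _ _).measure_lt_top
  filter_upwards [ae_all_iff.2 h1] with ω hω
  rw [locallyIntegrable_iff]
  intro k hk
  obtain ⟨n, hn⟩ := hk.isBounded.subset_closedBall (0 : E d)
  obtain ⟨m, hm⟩ := exists_nat_ge n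
  refine IntegrableOn.mono_set ⟨(measurable_realisation hf ω).aestronglyMeasurable, hω m⟩
    (hn.trans (Metric.closedBall_subset_closedBall hm))

end Action

/-! ### Convolution of bounded functions on `ℝ^d` -/

theorem norm_convolution_le {F G : Type*} [NormedAddCommGroup F] [NormedSpace ℝ F]
    [NormedAddCommGroup G] [NormedSpace ℝ G] (L : F →L[ℝ] ℝ →L[ℝ] G) {K : E d → F}
    (hK : Integrable K volume) {u : E d → ℝ} {M : ℝ} (hu : ∀ x, |u x| ≤ M) (x : E d) :
    ‖(convolution K u L volume) x‖ ≤ ‖L‖ * M * ∫ t, ‖K t‖ := by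
  rw [convolution_def, ← integral_const_mul]
  refine norm_integral_le_of_norm_le (hK.norm.const_mul _) (Eventually.of_forall fun t => ?_)
  calc ‖L (K t) (u (x - t))‖ ≤ ‖L‖ * ‖K t‖ * ‖u (x - t)‖ := L.le_opNorm₂ _ _
    _ ≤ ‖L‖ * ‖K t‖ * M := by gcongr; exact hu _
    _ = _ := by ring

/-- Convolution with a fixed test function maps bounded functions to functions with bounded
derivatives of all orders. -/
theorem exists_bound_iteratedFDeriv_convolution (n : ℕ) :
    ∀ (F G : Type) [NormedAddCommGroup F] [NormedSpace ℝ F] [NormedAddCommGroup G]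
      [NormedSpace ℝ G] (L : F →L[ℝ] ℝ →L[ℝ] G) (K : E d → F),
      ContDiff ℝ (⊤ : ℕ∞) K → HasCompactSupport K → ∀ M : ℝ, ∃ C : ℝ, ∀ u : E d → ℝ,
      LocallyIntegrable u volume → (∀ x, |u x| ≤ M) →
      ∀ x, ‖iteratedFDeriv ℝ n (convolution K u L volume) x‖ ≤ C := by
  induction n with
  | zero =>
    intro F G _ _ _ _ L K hK hc M
    refine ⟨‖L‖ * M * ∫ t, ‖K t‖, fun u _ hM x => ?_⟩
    rw [norm_iteratedFDeriv_zero]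
    exact norm_convolution_le L (hK.continuous.integrable_of_hasCompactSupport hc) hM x
  | succ n ih =>
    intro F G _ _ _ _ L K hK hc M
    -- Each derivative falls on the kernel, whose values then lie in a new space; hence the
    -- induction over all `F` and `G`. `C` depends on `u` only through `M`, which later makes it
    -- uniform in `ω`.
    obtain ⟨C, hC⟩ := ih (E d →L[ℝ] F) (E d →L[ℝ] G) (L.precompL (E d)) (fderiv ℝ K)
      (hK.fderiv_right (by exact_mod_cast le_top)) (hc.fderiv ℝ) M
    refine ⟨C, fun u hu hM x => ?_⟩
    rw [← norm_iteratedFDeriv_fderiv]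
    have : fderiv ℝ (convolution K u L volume) =
        convolution (fderiv ℝ K) u (L.precompL (E d)) volume := by
      ext1 y
      exact (hc.hasFDerivAt_convolution_left L (hK.of_le (by exact_mod_cast le_top)) hu y).fderiv
    rw [this]
    exact hC u hu hM x

end

section

variable {d : ℕ} {Ω : Type*} [AddAction (E d) Ω]

/-! ### Mollification along the action -/

/-- The mollification of `f` by a kernel `K` on `ℝ^d`, along the orbits of the action. -/
noncomputable def mollify (K : E d → ℝ) (f : Ω → ℝ) (ω : Ω) : ℝ :=
  ∫ t, K t * f (-t +ᵥ ω)

theorem realisation_vadd (f : Ω → ℝ) (x : E d) (ω : Ω) :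
    realisation d f (x +ᵥ ω) = fun y => realisation d f ω (y + x) := by
  ext y
  simp [realisation, add_vadd]

/-- This identity transports convolution theory on `ℝ^d` to `Ω`, one orbit at a time. -/
theorem realisation_mollify (K : E d → ℝ) (f : Ω → ℝ) (ω : Ω) :
    realisation d (mollify K f) ω =
      convolution K (realisation d f ω) (ContinuousLinearMap.lsmul ℝ ℝ) volume := by
  ext x
  rw [convolution_def]
  simp only [realisation, mollify, vadd_vadd, ContinuousLinearMap.lsmul_apply, smul_eq_mul]
  congr 1 with t
  rw [neg_add_eq_sub]

theorem abs_mollify_le {K : E d → ℝ} (hK : Integrable K volume) {f : Ω → ℝ} {M : ℝ}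
    (hf : ∀ ω, |f ω| ≤ M) (ω : Ω) : |mollify K f ω| ≤ M * ∫ t, |K t| := by
  rw [← integral_const_mul, ← Real.norm_eq_abs]
  refine norm_integral_le_of_norm_le (hK.norm.const_mul _) (Eventually.of_forall fun t => ?_)
  rw [norm_mul, mul_comm]
  exact mul_le_mul_of_nonneg_right (hf _) (norm_nonneg _)

/-! ### A sequence of mollifiers -/

/-- A bump function supported in the ball of radius `2 / (n + 1)`. -/
noncomputable def bump (d n : ℕ) : ContDiffBump (0 : E d) where
  rIn := 1 / ((n : ℝ) + 1)
  rOut := 2 / ((n : ℝ) + 1)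
  rIn_pos := by positivity
  rIn_lt_rOut := by gcongr; norm_num

/-- The standard sequence of smooth even probability densities concentrating at the origin. -/
noncomputable def kernel (d n : ℕ) : E d → ℝ := (bump d n).normed volume

theorem contDiff_kernel (n : ℕ) : ContDiff ℝ (⊤ : ℕ∞) (kernel d n) :=
  (bump d n).contDiff_normed

theorem hasCompactSupport_kernel (n : ℕ) : HasCompactSupport (kernel d n) :=
  (bump d n).hasCompactSupport_normed

theorem measurable_kernel (n : ℕ) : Measurable (kernel d n) :=
  (contDiff_kernel n).continuous.measurable

theorem integrable_kernel (n : ℕ) : Integrable (kernel d n) volume :=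
  (bump d n).integrable_normed

theorem kernel_nonneg (n : ℕ) (x : E d) : 0 ≤ kernel d n x := (bump d n).nonneg_normed x

theorem kernel_neg (n : ℕ) (x : E d) : kernel d n (-x) = kernel d n x :=
  (bump d n).normed_neg x

theorem integral_kernel (n : ℕ) : ∫ x, kernel d n x = 1 := (bump d n).integral_normed

theorem lintegral_enorm_kernel (n : ℕ) : ∫⁻ x, ‖kernel d n x‖ₑ = 1 := by
  have h := ofReal_integral_eq_lintegral_ofReal (integrable_kernel (d := d) n)
    (Eventually.of_forall (kernel_nonneg n))
  rw [integral_kernel, ENNReal.ofReal_one] at h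
  rw [h]
  congr 1 with x
  exact Real.enorm_of_nonneg (kernel_nonneg n x)

theorem mollify_kernel_const (n : ℕ) (c : ℝ) (ω : Ω) :
    mollify (kernel d n) (fun _ => c) ω = c := by
  simp [mollify, integral_mul_const, integral_kernel]

theorem abs_mollify_kernel_le (n : ℕ) {f : Ω → ℝ} {M : ℝ} (hf : ∀ ω, |f ω| ≤ M) (ω : Ω) :
    |mollify (kernel d n) f ω| ≤ M := by
  have := abs_mollify_le (integrable_kernel (d := d) n) hf ω
  simpa only [abs_of_nonneg (kernel_nonneg n _), integral_kernel, mul_one] using this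

/-- Lebesgue differentiation on a single orbit. The bumps shrink regularly: the outer radius is
twice the inner one, whence `K := 2`. -/
theorem tendsto_mollify_kernel_of_locallyIntegrable {f : Ω → ℝ} {ω : Ω}
    (h : LocallyIntegrable (realisation d f ω) volume) :
    ∀ᵐ x : E d, Tendsto (fun n => mollify (kernel d n) f (x +ᵥ ω)) atTop (𝓝 (f (x +ᵥ ω))) := by
  have h0 : Tendsto (fun n : ℕ => (bump d n).rOut) atTop (𝓝 0) := by
    have := (tendsto_one_div_add_atTop_nhds_zero_nat (𝕜 := ℝ)).const_mul 2
    simpa [bump, mul_one_div, div_eq_mul_inv] using this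
  filter_upwards [ContDiffBump.ae_convolution_tendsto_right_of_locallyIntegrable (K := 2) h0
    (Eventually.of_forall fun n => by simp [bump, div_eq_mul_inv]) h] with x hx
  refine hx.congr fun n => ?_
  rw [← kernel, ← realisation_mollify]
  rfl

/-! ### Measurability and `L²` bounds -/

variable [MeasurableSpace Ω] [MeasurableVAdd₂ (E d) Ω]

theorem measurable_mollify_integrand {K : E d → ℝ} (hK : Measurable K) {f : Ω → ℝ}
    (hf : Measurable f) : Measurable (fun p : Ω × E d => K p.2 * f (-p.2 +ᵥ p.1)) :=
  (hK.comp measurable_snd).mul (hf.comp (measurable_snd.neg.vadd measurable_fst))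

theorem measurable_mollify {K : E d → ℝ} (hK : Measurable K) {f : Ω → ℝ} (hf : Measurable f) :
    Measurable (mollify K f) :=
  (measurable_mollify_integrand hK hf).stronglyMeasurable.integral_prod_right.measurable

variable {P : Measure Ω} [IsProbabilityMeasure P] [VAddInvariantMeasure (E d) Ω P]

/-- Cauchy–Schwarz after splitting `|K|` into two factors `|K|^{1/2}`; keeping one with `f` leaves a
weight that Fubini can integrate. -/
theorem enorm_mollify_sq_le {K : E d → ℝ} (hK : Measurable K) {f : Ω → ℝ} (hf : Measurable f)
    (ω : Ω) : ‖mollify K f ω‖ₑ ^ (2 : ℝ) ≤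
      (∫⁻ t, ‖K t‖ₑ) * ∫⁻ t, ‖K t‖ₑ * ‖f (-t +ᵥ ω)‖ₑ ^ (2 : ℝ) := by
  have hm : Measurable (fun t : E d => f (-t +ᵥ ω)) :=
    hf.comp (measurable_neg.vadd measurable_const)
  have h1 : ‖mollify K f ω‖ₑ ≤ ∫⁻ t, ‖K t‖ₑ ^ (1 / 2 : ℝ) *
      (‖K t‖ₑ ^ (1 / 2 : ℝ) * ‖f (-t +ᵥ ω)‖ₑ) := by
    refine (enorm_integral_le_lintegral_enorm _).trans (lintegral_mono fun t => ?_)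
    simp only
    rw [← mul_assoc, ← ENNReal.rpow_add_of_nonneg _ _ (by norm_num) (by norm_num), enorm_mul]
    norm_num
  have h2 := ENNReal.lintegral_mul_le_Lp_mul_Lq (volume : Measure (E d))
    (Real.HolderConjugate.two_two) (f := fun t => ‖K t‖ₑ ^ (1 / 2 : ℝ))
    (g := fun t => ‖K t‖ₑ ^ (1 / 2 : ℝ) * ‖f (-t +ᵥ ω)‖ₑ)
    (hK.enorm.pow_const _).aemeasurable ((hK.enorm.pow_const _).mul hm.enorm).aemeasurable
  have h3 := ENNReal.rpow_le_rpow (h1.trans h2) (by norm_num : (0 : ℝ) ≤ 2)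
  refine h3.trans (le_of_eq ?_)
  rw [ENNReal.mul_rpow_of_nonneg _ _ (by norm_num), ← ENNReal.rpow_mul, ← ENNReal.rpow_mul]
  norm_num
  congr 1
  · congr 1 with t
    rw [← ENNReal.rpow_natCast, ← ENNReal.rpow_mul]
    norm_num
  · congr 1 with t
    rw [mul_pow, ← ENNReal.rpow_natCast, ← ENNReal.rpow_mul]
    norm_num

/-- Mollification is bounded on `L²`. -/
theorem eLpNorm_mollify_le {K : E d → ℝ} (hK : Measurable K) {f : Ω → ℝ} (hf : Measurable f) :
    eLpNorm (mollify K f) 2 P ≤ (∫⁻ t, ‖K t‖ₑ) * eLpNorm f 2 P := by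
  have h2 : (2 : ℝ≥0∞).toReal = 2 := by norm_num
  simp only [eLpNorm_eq_lintegral_rpow_enorm_toReal (p := 2) (by norm_num) (by norm_num), h2]
  have hm : Measurable (fun p : Ω × E d => ‖K p.2‖ₑ * ‖f (-p.2 +ᵥ p.1)‖ₑ ^ (2 : ℝ)) :=
    (hK.comp measurable_snd).enorm.mul
      ((hf.comp (measurable_snd.neg.vadd measurable_fst)).enorm.pow_const _)
  have h3 : ∫⁻ ω, ‖mollify K f ω‖ₑ ^ (2 : ℝ) ∂P ≤
      (∫⁻ t, ‖K t‖ₑ) ^ (2 : ℝ) * ∫⁻ ω, ‖f ω‖ₑ ^ (2 : ℝ) ∂P := by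
    calc ∫⁻ ω, ‖mollify K f ω‖ₑ ^ (2 : ℝ) ∂P
        ≤ ∫⁻ ω, (∫⁻ t, ‖K t‖ₑ) * (∫⁻ t, ‖K t‖ₑ * ‖f (-t +ᵥ ω)‖ₑ ^ (2 : ℝ)) ∂P :=
          lintegral_mono fun ω => enorm_mollify_sq_le hK hf ω
      _ = (∫⁻ t, ‖K t‖ₑ) * ∫⁻ t, ∫⁻ ω, ‖K t‖ₑ * ‖f (-t +ᵥ ω)‖ₑ ^ (2 : ℝ) ∂P := by
          rw [lintegral_const_mul _ hm.lintegral_prod_right', lintegral_lintegral_swap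
            hm.aemeasurable]
      _ = (∫⁻ t, ‖K t‖ₑ) * ∫⁻ t, ‖K t‖ₑ * ∫⁻ ω, ‖f ω‖ₑ ^ (2 : ℝ) ∂P := by
          congr 2 with t
          rw [lintegral_const_mul]
          · rw [lintegral_vadd (f := fun ω => ‖f ω‖ₑ ^ (2 : ℝ)) (hf.enorm.pow_const _)]
          · exact (hf.comp (measurable_const_vadd (-t))).enorm.pow_const _
      _ = _ := by
          rw [lintegral_mul_const _ hK.enorm, ← mul_assoc, ENNReal.rpow_two, sq]
  calc _ ≤ ((∫⁻ t, ‖K t‖ₑ) ^ (2 : ℝ) * ∫⁻ ω, ‖f ω‖ₑ ^ (2 : ℝ) ∂P) ^ (1 / 2 : ℝ) := by gcongr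
    _ = _ := by
      rw [ENNReal.mul_rpow_of_nonneg _ _ (by norm_num), ← ENNReal.rpow_mul]
      norm_num

theorem memLp_mollify {K : E d → ℝ} (hK : Measurable K) (hi : Integrable K volume) {f : Ω → ℝ}
    (hf : Measurable f) (hf2 : MemLp f 2 P) : MemLp (mollify K f) 2 P :=
  ⟨(measurable_mollify hK hf).aestronglyMeasurable,
    (eLpNorm_mollify_le hK hf).trans_lt (ENNReal.mul_lt_top hi.2 hf2.2)⟩

theorem integrable_mollify_integrand {K : E d → ℝ} (hK : Measurable K)
    (hi : Integrable K volume) {f : Ω → ℝ} (hf : Measurable f) (hfi : Integrable f P) :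
    Integrable (fun p : Ω × E d => K p.2 * f (-p.2 +ᵥ p.1)) (P.prod volume) := by
  have hm := measurable_mollify_integrand hK hf
  refine ⟨hm.aestronglyMeasurable, ?_⟩
  rw [HasFiniteIntegral, lintegral_prod_symm' _ hm.enorm]
  have : ∀ t : E d, ∫⁻ ω, ‖K t * f (-t +ᵥ ω)‖ₑ ∂P = ‖K t‖ₑ * ∫⁻ ω, ‖f ω‖ₑ ∂P := by
    intro t
    simp only [enorm_mul]
    rw [lintegral_const_mul, lintegral_vadd (f := fun ω => ‖f ω‖ₑ) hf.enorm]
    exact (hf.comp (measurable_const_vadd (-t))).enorm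
  simp only [this]
  rw [lintegral_mul_const _ hK.enorm]
  exact ENNReal.mul_lt_top hi.2 hfi.2

/-- Linearity may fail on orbits where an integrand is not integrable, since the Bochner integral is
then `0` by default. Fubini makes these orbits negligible. -/
theorem mollify_sub_ae {K : E d → ℝ} (hK : Measurable K) (hi : Integrable K volume)
    {f g : Ω → ℝ} (hf : Measurable f) (hg : Measurable g) (hfi : Integrable f P)
    (hgi : Integrable g P) : mollify K (f - g) =ᵐ[P] mollify K f - mollify K g := by
  filter_upwards [(integrable_mollify_integrand hK hi hf hfi).prod_right_ae,
    (integrable_mollify_integrand hK hi hg hgi).prod_right_ae] with ω h1 h2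
  simp only [mollify, Pi.sub_apply]
  rw [← integral_sub h1 h2]
  simp only [mul_sub]

/-- Mollification by the reflected kernel is the adjoint of mollification. -/
theorem integral_mollify_mul {K : E d → ℝ} (hK : Measurable K) (hi : Integrable K volume)
    {f w : Ω → ℝ} (hf : Measurable f) (hfi : Integrable f P) (hw : Measurable w) {M : ℝ}
    (hM : ∀ ω, |w ω| ≤ M) :
    ∫ ω, mollify K f ω * w ω ∂P = ∫ ω, f ω * mollify (fun t => K (-t)) w ω ∂P := by
  have h1 : Integrable (fun p : Ω × E d => K p.2 * f (-p.2 +ᵥ p.1) * w p.1) (P.prod volume) :=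
    (integrable_mollify_integrand hK hi hf hfi).mul_bdd (c := M)
      (hw.comp measurable_fst).aestronglyMeasurable (Eventually.of_forall fun p => hM p.1)
  have h2 : Integrable (fun p : Ω × E d => f p.1 * (K p.2 * w (p.2 +ᵥ p.1))) (P.prod volume) := by
    have := (hfi.mul_prod hi).mul_bdd (c := M)
      (hw.comp (measurable_snd.vadd measurable_fst)).aestronglyMeasurable
      (Eventually.of_forall fun p : Ω × E d => hM (p.2 +ᵥ p.1))
    simpa [mul_assoc] using this
  calc ∫ ω, mollify K f ω * w ω ∂P = ∫ ω, (∫ t, K t * f (-t +ᵥ ω) * w ω) ∂P := by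
        simp only [mollify, integral_mul_const]
    _ = ∫ t, ∫ ω, K t * f (-t +ᵥ ω) * w ω ∂P := integral_integral_swap h1
    _ = ∫ t, ∫ ω, f ω * (K t * w (t +ᵥ ω)) ∂P := by
        congr 1 with t
        -- For fixed `t`, the substitution `ω ↦ t +ᵥ ω` moves the shift from `f` to `w`.
        rw [← integral_vadd_eq_self (μ := P) (fun ω => K t * f (-t +ᵥ ω) * w ω) (g := t)]
        simp only [neg_vadd_vadd]
        congr 1 with ω
        ring
    _ = ∫ ω, (∫ t, f ω * (K t * w (t +ᵥ ω))) ∂P := (integral_integral_swap h2).symm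
    _ = _ := by
        congr 1 with ω
        rw [integral_const_mul, mollify,
          ← integral_neg_eq_self (fun t : E d => K t * w (t +ᵥ ω))]

theorem le_mollify_kernel (n : ℕ) {f : Ω → ℝ} (hf : Measurable f) {c M : ℝ}
    (hM : ∀ ω, |f ω| ≤ M) (hc : ∀ ω, c ≤ f ω) (ω : Ω) : c ≤ mollify (kernel d n) f ω := by
  refine (mollify_kernel_const (d := d) n c ω).symm.trans_le ?_
  refine integral_mono ((integrable_kernel n).mul_const c) ?_ fun t =>
    mul_le_mul_of_nonneg_left (hc _) (kernel_nonneg n t)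
  exact (integrable_kernel n).mul_bdd (c := M)
    (hf.comp (measurable_neg.vadd measurable_const)).aestronglyMeasurable
    (Eventually.of_forall fun t => hM _)

/-- The adjoint identity tested against the constant `1`, which mollification fixes. -/
theorem integral_mollify_kernel (n : ℕ) {f : Ω → ℝ} (hf : Measurable f) (hfi : Integrable f P) :
    ∫ ω, mollify (kernel d n) f ω ∂P = ∫ ω, f ω ∂P := by
  have := integral_mollify_mul (d := d) (P := P) (measurable_kernel n) (integrable_kernel n) hf hfi
    (w := fun _ => 1) measurable_const (M := 1) (by simp)
  simpa only [kernel_neg, mollify_kernel_const, mul_one] using this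

theorem ae_tendsto_mollify_kernel {f : Ω → ℝ} (hf : Measurable f) (hfi : Integrable f P) :
    ∀ᵐ ω ∂P, Tendsto (fun n => mollify (kernel d n) f ω) atTop (𝓝 (f ω)) := by
  refine ae_of_ae_ae_vadd (d := d) ?_ ?_
  · exact measurableSet_tendsto_fun (fun n => measurable_mollify (measurable_kernel n) hf) hf
  · filter_upwards [ae_locallyIntegrable_realisation (d := d) hf hfi] with ω hω
    exact tendsto_mollify_kernel_of_locallyIntegrable hω

theorem tendsto_eLpNorm_mollify_kernel_of_bounded {f : Ω → ℝ} (hf : Measurable f) {M : ℝ}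
    (hM : ∀ ω, |f ω| ≤ M) :
    Tendsto (fun n => eLpNorm (mollify (kernel d n) f - f) 2 P) atTop (𝓝 0) := by
  have hfi : Integrable f P := Integrable.of_bound hf.aestronglyMeasurable M
    (Eventually.of_forall hM)
  refine tendsto_eLpNorm_two_of_dominated (G := fun _ => M + M)
    (fun n => (measurable_mollify (measurable_kernel n) hf).aestronglyMeasurable)
    hf.aestronglyMeasurable (memLp_const _) (fun n => Eventually.of_forall fun ω => ?_)
    (ae_tendsto_mollify_kernel hf hfi)
  exact (abs_sub _ _).trans (add_le_add (abs_mollify_kernel_le n hM ω) (hM ω))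

/-! ### Smooth truncation -/

/-- A smooth bounded approximation of the identity function. -/
noncomputable def softTrunc (m : ℕ) (s : ℝ) : ℝ := (m + 1) * Real.arctan (s / (m + 1))

theorem hasDerivAt_softTrunc (m : ℕ) (s : ℝ) :
    HasDerivAt (softTrunc m) (1 / (1 + (s / (m + 1)) ^ 2)) s := by
  have h : ((m : ℝ) + 1) ≠ 0 := by positivity
  have := (((hasDerivAt_id s).div_const ((m : ℝ) + 1)).arctan).const_mul ((m : ℝ) + 1)
  refine this.congr_deriv ?_
  simp only [id]
  field_simp

theorem contDiff_softTrunc (m : ℕ) : ContDiff ℝ (⊤ : ℕ∞) (softTrunc m) :=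
  contDiff_const.mul (Real.contDiff_arctan.comp (contDiff_id.div_const _))

theorem measurable_softTrunc (m : ℕ) : Measurable (softTrunc m) :=
  (contDiff_softTrunc m).continuous.measurable

theorem abs_softTrunc_le (m : ℕ) (s : ℝ) : |softTrunc m s| ≤ (m + 1) * (Real.pi / 2) := by
  rw [softTrunc, abs_mul, abs_of_nonneg (by positivity : (0 : ℝ) ≤ m + 1)]
  gcongr
  exact abs_le.2 ⟨(Real.neg_pi_div_two_lt_arctan _).le, (Real.arctan_lt_pi_div_two _).le⟩

theorem abs_deriv_softTrunc_le (m : ℕ) (s : ℝ) : |1 / (1 + (s / ((m : ℝ) + 1)) ^ 2)| ≤ 1 := by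
  rw [abs_of_nonneg (by positivity)]
  rw [div_le_one (by positivity)]
  nlinarith [sq_nonneg (s / ((m : ℝ) + 1))]

theorem abs_softTrunc_le_abs (m : ℕ) (s : ℝ) : |softTrunc m s| ≤ |s| := by
  have := (convex_univ (𝕜 := ℝ) (E := ℝ)).norm_image_sub_le_of_norm_hasDerivWithin_le
    (f := softTrunc m) (C := 1) (x := 0) (y := s)
    (fun x _ => (hasDerivAt_softTrunc m x).hasDerivWithinAt)
    (fun x _ => abs_deriv_softTrunc_le m x) trivial trivial
  simpa [softTrunc] using this

theorem tendsto_div_nat_add_one (s : ℝ) :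
    Tendsto (fun m : ℕ => s / ((m : ℝ) + 1)) atTop (𝓝 0) := by
  simpa [div_eq_mul_inv] using (tendsto_one_div_add_atTop_nhds_zero_nat (𝕜 := ℝ)).const_mul s

theorem tendsto_deriv_softTrunc (s : ℝ) :
    Tendsto (fun m : ℕ => 1 / (1 + (s / ((m : ℝ) + 1)) ^ 2)) atTop (𝓝 1) := by
  have := (((tendsto_div_nat_add_one s).pow 2).const_add 1).inv₀ (by norm_num)
  simpa using this

theorem tendsto_softTrunc (s : ℝ) : Tendsto (fun m => softTrunc m s) atTop (𝓝 s) := by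
  by_cases hs : s = 0
  · subst hs
    simp [softTrunc]
  -- For `s ≠ 0`, `softTrunc m s` is `s` times the slope of arctan between `0` and `s / (m + 1)`,
  -- and the slope tends to `1`.
  have h1 := (Real.hasDerivAt_arctan 0).tendsto_slope
  have h2 : Tendsto (fun m : ℕ => s / ((m : ℝ) + 1)) atTop (𝓝[≠] 0) :=
    tendsto_nhdsWithin_iff.2 ⟨tendsto_div_nat_add_one s, Eventually.of_forall fun m => by
      simp only [Set.mem_compl_iff, Set.mem_singleton_iff]; positivity⟩
  have h3 := (h1.comp h2).mul_const s
  refine Tendsto.congr (fun m => ?_) (by simpa using h3)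
  have : ((m : ℝ) + 1) ≠ 0 := by positivity
  simp only [slope_def_field, Real.arctan_zero, softTrunc]
  field_simp
  simp [hs]

section

variable {α : Type*} [MeasurableSpace α] {μ : Measure α}

theorem memLp_softTrunc_comp [IsFiniteMeasure μ] (m : ℕ) {f : α → ℝ} (hf : Measurable f)
    {p : ℝ≥0∞} : MemLp (softTrunc m ∘ f) p μ :=
  MemLp.of_bound ((measurable_softTrunc m).comp hf).aestronglyMeasurable _
    (Eventually.of_forall fun ω => abs_softTrunc_le m (f ω))

theorem tendsto_eLpNorm_softTrunc {f : α → ℝ} (hf : Measurable f) (hf2 : MemLp f 2 μ) :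
    Tendsto (fun m => eLpNorm (softTrunc m ∘ f - f) 2 μ) atTop (𝓝 0) := by
  refine tendsto_eLpNorm_two_of_dominated (G := fun ω => |f ω| + |f ω|)
    (fun m => ((measurable_softTrunc m).comp hf).aestronglyMeasurable) hf.aestronglyMeasurable
    (hf2.abs.add hf2.abs) (fun m => Eventually.of_forall fun ω => ?_)
    (Eventually.of_forall fun ω => tendsto_softTrunc _)
  exact (abs_sub _ _).trans (add_le_add (abs_softTrunc_le_abs m _) le_rfl)

theorem tendsto_eLpNorm_deriv_softTrunc_mul {f g : α → ℝ} (hf : Measurable f)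
    (hg : Measurable g) (hg2 : MemLp g 2 μ) :
    Tendsto (fun m : ℕ => eLpNorm
      ((fun ω => 1 / (1 + (f ω / ((m : ℝ) + 1)) ^ 2) * g ω) - g) 2 μ) atTop (𝓝 0) := by
  refine tendsto_eLpNorm_two_of_dominated (G := fun ω => |g ω| + |g ω|)
    (fun m => Measurable.aestronglyMeasurable (by fun_prop)) hg.aestronglyMeasurable
    (hg2.abs.add hg2.abs) (fun m => Eventually.of_forall fun ω => ?_)
    (Eventually.of_forall fun ω => ?_)
  · refine (abs_sub _ _).trans (add_le_add ?_ le_rfl)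
    rw [abs_mul]
    exact mul_le_of_le_one_left (abs_nonneg _) (abs_deriv_softTrunc_le m _)
  · simpa using (tendsto_deriv_softTrunc (f ω)).mul_const (g ω)

end

/-- An `ε/3` argument: bounded functions are settled by dominated convergence, and mollification,
being an `L²` contraction, does not enlarge the truncation error. -/
theorem tendsto_eLpNorm_mollify_kernel {f : Ω → ℝ} (hf : Measurable f) (hf2 : MemLp f 2 P) :
    Tendsto (fun n => eLpNorm (mollify (kernel d n) f - f) 2 P) atTop (𝓝 0) := by
  rw [ENNReal.tendsto_nhds_zero]
  intro ε hε
  have hε3 : 0 < ε / 3 := ENNReal.div_pos hε.ne' (by norm_num)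
  obtain ⟨m, hm⟩ := ((ENNReal.tendsto_nhds_zero.1 (tendsto_eLpNorm_softTrunc hf hf2)) _ hε3).exists
  have hb : Measurable (softTrunc m ∘ f) := (measurable_softTrunc m).comp hf
  filter_upwards [ENNReal.tendsto_nhds_zero.1 (tendsto_eLpNorm_mollify_kernel_of_bounded (d := d)
    (P := P) hb (fun ω => abs_softTrunc_le m (f ω))) _ hε3] with n hn
  have hK := measurable_kernel (d := d) n
  have hK' := integrable_kernel (d := d) n
  have hb2 : MemLp (softTrunc m ∘ f) 2 P := memLp_softTrunc_comp m hf
  have h1 : eLpNorm (mollify (kernel d n) f - mollify (kernel d n) (softTrunc m ∘ f)) 2 P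
      ≤ ε / 3 := by
    rw [← eLpNorm_congr_ae (mollify_sub_ae (d := d) hK hK' hf hb (hf2.integrable (by norm_num))
      (hb2.integrable (by norm_num)))]
    refine (eLpNorm_mollify_le hK (hf.sub hb)).trans ?_
    rw [lintegral_enorm_kernel, one_mul, eLpNorm_sub_comm]
    exact hm
  have e1 : mollify (kernel d n) f - f =
      (mollify (kernel d n) f - mollify (kernel d n) (softTrunc m ∘ f)) +
      ((mollify (kernel d n) (softTrunc m ∘ f) - softTrunc m ∘ f) + (softTrunc m ∘ f - f)) := by
    ring
  have m1 := (measurable_mollify hK hf).aestronglyMeasurable (μ := P)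
  have m2 := (measurable_mollify hK hb).aestronglyMeasurable (μ := P)
  rw [e1]
  calc _ ≤ _ := eLpNorm_add_le (m1.sub m2) ((m2.sub hb2.1).add (hb2.1.sub hf2.1)) (by norm_num)
    _ ≤ ε / 3 + (ε / 3 + ε / 3) := add_le_add h1 ((eLpNorm_add_le (m2.sub hb2.1)
        (hb2.1.sub hf2.1) (by norm_num)).trans (add_le_add hn hm))
    _ = ε := by rw [← add_assoc, ENNReal.add_thirds]

end

section

variable {d : ℕ}

/-! ### Weak derivatives on `ℝ^d` -/

theorem contDiff_partial {K : E d → ℝ} (hK : ContDiff ℝ (⊤ : ℕ∞) K) (v : E d) :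
    ContDiff ℝ (⊤ : ℕ∞) (fun t => fderiv ℝ K t v) :=
  (hK.fderiv_right (by exact_mod_cast le_top)).clm_apply contDiff_const

theorem hasCompactSupport_partial {K : E d → ℝ} (hc : HasCompactSupport K) (v : E d) :
    HasCompactSupport (fun t => fderiv ℝ K t v) :=
  (hc.fderiv ℝ).comp_left (g := fun L : E d →L[ℝ] ℝ => L v) rfl

theorem isEuclideanWeakPartial_of_contDiff (i : Fin d) {u : E d → ℝ} (hu : ContDiff ℝ 1 u) :
    IsEuclideanWeakPartial i u (fun x => fderiv ℝ u x (e i)) := by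
  have hu' : Continuous (fun x => fderiv ℝ u x (e i)) :=
    (hu.continuous_fderiv (by norm_num)).clm_apply continuous_const
  refine ⟨hu.continuous.locallyIntegrable, hu'.locallyIntegrable, fun φ hφ hc => ?_⟩
  refine integral_mul_fderiv_eq_neg_fderiv_mul_of_integrable ?_ ?_ ?_
    (fun x _ => hu.differentiable (by norm_num) x)
    (fun x _ => hφ.differentiable (by simp) x)
  · exact (hu'.mul hφ.continuous).integrable_of_hasCompactSupport hc.mul_left
  · exact (hu.continuous.mul (contDiff_partial hφ _).continuous).integrable_of_hasCompactSupport
      (hasCompactSupport_partial hc _).mul_left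
  · exact (hu.continuous.mul hφ.continuous).integrable_of_hasCompactSupport hc.mul_left

theorem IsEuclideanWeakPartial.sub {i : Fin d} {u v u' v' : E d → ℝ}
    (h : IsEuclideanWeakPartial i u v) (h' : IsEuclideanWeakPartial i u' v') :
    IsEuclideanWeakPartial i (u - u') (v - v') := by
  refine ⟨h.1.sub h'.1, h.2.1.sub h'.2.1, fun φ hφ hc => ?_⟩
  have hp := (contDiff_partial hφ (e i)).continuous
  have hpc := hasCompactSupport_partial hc (e i)
  have i1 := h.1.integrable_smul_right_of_hasCompactSupport hp hpc
  have i2 := h'.1.integrable_smul_right_of_hasCompactSupport hp hpc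
  have i3 := h.2.1.integrable_smul_right_of_hasCompactSupport hφ.continuous hc
  have i4 := h'.2.1.integrable_smul_right_of_hasCompactSupport hφ.continuous hc
  simp only [smul_eq_mul] at i1 i2 i3 i4
  simp only [Pi.sub_apply, sub_mul]
  rw [integral_sub i1 i2, integral_sub i3 i4, h.2.2 φ hφ hc, h'.2.2 φ hφ hc]
  ring

theorem contDiff_convolution {K : E d → ℝ} (hK : ContDiff ℝ (⊤ : ℕ∞) K)
    (hc : HasCompactSupport K) {u : E d → ℝ} (hu : LocallyIntegrable u volume) :
    ContDiff ℝ (⊤ : ℕ∞) (convolution K u (ContinuousLinearMap.lsmul ℝ ℝ) volume) :=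
  hc.contDiff_convolution_left _ hK hu

theorem convolution_precompL_apply {K : E d → (E d →L[ℝ] ℝ)} (hK : Continuous K)
    (hc : HasCompactSupport K) {u : E d → ℝ} (hu : LocallyIntegrable u volume) (x v : E d) :
    convolution K u ((ContinuousLinearMap.lsmul ℝ ℝ : ℝ →L[ℝ] ℝ →L[ℝ] ℝ).precompL (E d)) volume x v =
      convolution (fun t => K t v) u (ContinuousLinearMap.lsmul ℝ ℝ) volume x := by
  have hi := hc.convolutionExists_left
    ((ContinuousLinearMap.lsmul ℝ ℝ : ℝ →L[ℝ] ℝ →L[ℝ] ℝ).precompL (E d)) hK hu x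
  rw [convolution_def, convolution_def]
  exact ContinuousLinearMap.integral_apply hi v

theorem fderiv_convolution_apply {K : E d → ℝ} (hK : ContDiff ℝ (⊤ : ℕ∞) K)
    (hc : HasCompactSupport K) {u : E d → ℝ} (hu : LocallyIntegrable u volume) (x v : E d) :
    fderiv ℝ (convolution K u (ContinuousLinearMap.lsmul ℝ ℝ) volume) x v =
      convolution (fun t => fderiv ℝ K t v) u (ContinuousLinearMap.lsmul ℝ ℝ) volume x := by
  have h1 : ContDiff ℝ 1 K := hK.of_le (by exact_mod_cast le_top)
  have h2 := (hc.hasFDerivAt_convolution_left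
    (ContinuousLinearMap.lsmul ℝ ℝ : ℝ →L[ℝ] ℝ →L[ℝ] ℝ) h1 hu x).fderiv
  rw [← convolution_precompL_apply (h1.continuous_fderiv (by norm_num)) (hc.fderiv ℝ) hu]
  exact congrArg (fun L : E d →L[ℝ] ℝ => L v) h2

/-- Use `y ↦ K (x - y)` as test function: the sign from the reflection cancels the sign in the
definition of the weak derivative. -/
theorem IsEuclideanWeakPartial.fderiv_convolution {i : Fin d} {u v : E d → ℝ}
    (h : IsEuclideanWeakPartial i u v) {K : E d → ℝ} (hK : ContDiff ℝ (⊤ : ℕ∞) K)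
    (hc : HasCompactSupport K) (x : E d) :
    fderiv ℝ (convolution K u (ContinuousLinearMap.lsmul ℝ ℝ) volume) x (e i) =
      convolution K v (ContinuousLinearMap.lsmul ℝ ℝ) volume x := by
  have hφ : ContDiff ℝ (⊤ : ℕ∞) (fun y => K (x - y)) := hK.comp (contDiff_const.sub contDiff_id)
  have hφc : HasCompactSupport (fun y => K (x - y)) :=
    hc.comp_homeomorph (Homeomorph.subLeft x)
  have hd : ∀ y, fderiv ℝ (fun y => K (x - y)) y (e i) = - fderiv ℝ K (x - y) (e i) := by
    intro y
    have h1 : HasFDerivAt (fun y : E d => x - y) (-ContinuousLinearMap.id ℝ (E d)) y :=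
      (hasFDerivAt_id y).const_sub x
    have h2 := ((hK.differentiable (by simp) (x - y)).hasFDerivAt.comp y h1).fderiv
    simp only [Function.comp_def] at h2
    rw [h2]
    simp
  have key := h.2.2 _ hφ hφc
  simp only [hd, mul_neg, integral_neg, neg_inj] at key
  rw [fderiv_convolution_apply hK hc h.1, convolution_eq_swap, convolution_eq_swap]
  simpa [mul_comm] using key

/-! ### Weak derivatives on `Ω` -/

variable {Ω : Type*} [AddAction (E d) Ω]

theorem realisation_classicalPartial (i : Fin d) (f : Ω → ℝ) (ω : Ω) :
    realisation d (classicalPartial i f) ω = fun x => fderiv ℝ (realisation d f ω) x (e i) := by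
  ext x
  rw [realisation, classicalPartial, realisation_vadd, fderiv_comp_add_right, zero_add]

/-- Difference quotients along a sequence serve twice: for measurability of the derivative and,
through invariance, for its zero mean. -/
theorem tendsto_classicalPartial (i : Fin d) {f : Ω → ℝ} {ω : Ω}
    (hf : DifferentiableAt ℝ (realisation d f ω) 0) :
    Tendsto (fun n : ℕ => ((n : ℝ) + 1) *
      (f (((1 / ((n : ℝ) + 1)) • (e i : E d)) +ᵥ ω) - f ω)) atTop
      (𝓝 (classicalPartial i f ω)) := by
  have h := hf.hasFDerivAt.lim (e i : E d) (c := fun n : ℕ => ((n : ℝ) + 1)) (l := atTop) ?_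
  · simpa [realisation, classicalPartial] using h
  · exact tendsto_norm_atTop_atTop.comp
      (tendsto_atTop_add_const_right _ _ tendsto_natCast_atTop_atTop)

variable [MeasurableSpace Ω] [MeasurableVAdd₂ (E d) Ω]

theorem measurable_classicalPartial (i : Fin d) {f : Ω → ℝ} (hf : Measurable f)
    (hd : ∀ ω, DifferentiableAt ℝ (realisation d f ω) 0) :
    Measurable (classicalPartial i f) := by
  refine measurable_of_tendsto_metrizable (fun n : ℕ => ?_)
    (tendsto_pi_nhds.2 fun ω => tendsto_classicalPartial i (hd ω))
  exact ((hf.comp (measurable_const_vadd _)).sub hf).const_mul _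

variable {P : Measure Ω} [IsProbabilityMeasure P] [VAddInvariantMeasure (E d) Ω P]

theorem IsWeakPartial.sub {i : Fin d} {f g f' g' : Ω → ℝ} (h : IsWeakPartial P i f g)
    (h' : IsWeakPartial P i f' g') : IsWeakPartial P i (f - f') (g - g') := by
  refine ⟨h.1.sub h'.1, ?_⟩
  filter_upwards [h.2, h'.2] with ω h1 h2 using h1.sub h2

theorem IsWeakPartial.congr {i : Fin d} {f g f' : Ω → ℝ} (h : IsWeakPartial P i f g)
    (hff' : f =ᵐ[P] f') : IsWeakPartial P i f' g := by
  refine ⟨h.1, ?_⟩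
  filter_upwards [h.2, ae_realisation_eq (d := d) hff'] with ω h1 h2
  refine ⟨(locallyIntegrable_congr h2).1 h1.1, h1.2.1, fun φ hφ hc => ?_⟩
  rw [← h1.2.2 φ hφ hc]
  refine integral_congr_ae ?_
  filter_upwards [h2] with x hx
  rw [hx]

theorem isWeakPartial_of_ae_smooth (i : Fin d) {f g : Ω → ℝ} (hg : Measurable g)
    (h : ∀ᵐ ω ∂P, ContDiff ℝ 1 (realisation d f ω) ∧
      realisation d g ω = fun x => fderiv ℝ (realisation d f ω) x (e i)) :
    IsWeakPartial P i f g := by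
  refine ⟨hg, ?_⟩
  filter_upwards [h] with ω hω
  rw [hω.2]
  exact isEuclideanWeakPartial_of_contDiff i hω.1

/-- The mollification of a weakly differentiable function has almost surely smooth realisations,
whose derivative is the mollification of the weak derivative. -/
theorem IsWeakPartial.mollify_smooth {i : Fin d} {f g : Ω → ℝ} (h : IsWeakPartial P i f g)
    {K : E d → ℝ} (hK : ContDiff ℝ (⊤ : ℕ∞) K) (hc : HasCompactSupport K) :
    ∀ᵐ ω ∂P, ContDiff ℝ 1 (realisation d (mollify K f) ω) ∧
      realisation d (mollify K g) ω = fun x => fderiv ℝ (realisation d (mollify K f) ω) x (e i) := by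
  filter_upwards [h.2] with ω hω
  simp only [realisation_mollify]
  refine ⟨(contDiff_convolution hK hc hω.1).of_le (by exact_mod_cast le_top), ?_⟩
  ext x
  rw [hω.fderiv_convolution hK hc]

theorem IsWeakPartial.mollify {i : Fin d} {f g : Ω → ℝ} (h : IsWeakPartial P i f g)
    {K : E d → ℝ} (hK : ContDiff ℝ (⊤ : ℕ∞) K) (hc : HasCompactSupport K) :
    IsWeakPartial P i (mollify K f) (mollify K g) :=
  isWeakPartial_of_ae_smooth i (measurable_mollify hK.continuous.measurable h.1)
    (h.mollify_smooth hK hc)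

/-- Here the derivative is put on the kernel, so `f` only has to be integrable. -/
theorem ae_smooth_mollify {i : Fin d} {f : Ω → ℝ} (hf : Measurable f)
    (hfi : Integrable f P) {K : E d → ℝ} (hK : ContDiff ℝ (⊤ : ℕ∞) K)
    (hc : HasCompactSupport K) :
    ∀ᵐ ω ∂P, ContDiff ℝ 1 (realisation d (mollify K f) ω) ∧
      realisation d (mollify (fun t => fderiv ℝ K t (e i)) f) ω =
        fun x => fderiv ℝ (realisation d (mollify K f) ω) x (e i) := by
  filter_upwards [ae_locallyIntegrable_realisation (d := d) hf hfi] with ω hω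
  simp only [realisation_mollify]
  refine ⟨(contDiff_convolution hK hc hω).of_le (by exact_mod_cast le_top), ?_⟩
  ext x
  rw [fderiv_convolution_apply hK hc hω]

/-- Membership in `𝔻_w` and the graph norm through arbitrary versions of the derivatives. -/
theorem mem_Dw_of {f : Ω → ℝ} {g : Fin d → Ω → ℝ} (hf : Measurable f) (hf2 : MemLp f 2 P)
    (hg : ∀ i, IsWeakPartial P i f (g i)) (hg2 : ∀ i, MemLp (g i) 2 P) : f ∈ Dw d P := by
  refine ⟨hf, hf2, fun i => ⟨hf, hf2, ⟨_, hg i⟩, ?_⟩⟩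
  exact (memLp_congr_ae ((hg i).ae_unique (isWeakPartial_weakPartial ⟨_, hg i⟩))).1 (hg2 i)

theorem isWeakPartial_of_mem_Dw {f : Ω → ℝ} (hf : f ∈ Dw d P) (i : Fin d) :
    IsWeakPartial P i f (weakPartial P i f) :=
  isWeakPartial_weakPartial (hf.2.2 i).2.2.1

theorem weakPartial_ae_eq {i : Fin d} {f g : Ω → ℝ} (hg : IsWeakPartial P i f g) :
    weakPartial P i f =ᵐ[P] g :=
  (isWeakPartial_weakPartial ⟨_, hg⟩).ae_unique hg

/-- The version selected by choice in `weakPartial` is immaterial; explicit derivatives can be used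
throughout. -/
theorem gradNorm_eq {f : Ω → ℝ} {g : Fin d → Ω → ℝ} (hg : ∀ i, IsWeakPartial P i f (g i)) :
    gradNorm d P f = eLpNorm f 2 P + ∑ i, eLpNorm (g i) 2 P := by
  rw [gradNorm]
  congr 1
  exact Finset.sum_congr rfl fun i _ => eLpNorm_congr_ae (weakPartial_ae_eq (hg i))

/-! ### The space `𝔻_s` -/

section Ds

variable {f : Ω → ℝ}

theorem isWeakPartial_classicalPartial (i : Fin d) (hf : Measurable f)
    (hs : ∀ ω, ContDiff ℝ (⊤ : ℕ∞) (realisation d f ω)) :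
    IsWeakPartial P i f (classicalPartial i f) :=
  isWeakPartial_of_ae_smooth i
    (measurable_classicalPartial i hf fun ω => (hs ω).differentiable (by simp) 0)
    (Eventually.of_forall fun ω => ⟨(hs ω).of_le (by exact_mod_cast le_top),
      realisation_classicalPartial i f ω⟩)

/-- Evaluation at the unit vector `e i` has operator norm at most one; this makes `Ds` stable under
partial derivatives. -/
theorem norm_iteratedFDeriv_classicalPartial_le (i : Fin d)
    (hs : ∀ ω, ContDiff ℝ (⊤ : ℕ∞) (realisation d f ω)) (n : ℕ) (ω : Ω) :
    ‖iteratedFDeriv ℝ n (realisation d (classicalPartial i f) ω) 0‖ ≤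
      ‖iteratedFDeriv ℝ (n + 1) (realisation d f ω) 0‖ := by
  rw [realisation_classicalPartial, ← norm_iteratedFDeriv_fderiv]
  have h := ((ContinuousLinearMap.apply ℝ ℝ (e i : E d))).norm_iteratedFDeriv_comp_left
    (f := fderiv ℝ (realisation d f ω)) (x := 0) (n := n) (N := (⊤ : ℕ∞))
    (((hs ω).fderiv_right (by exact_mod_cast le_top)).contDiffAt) (by exact_mod_cast le_top)
  refine h.trans (mul_le_of_le_one_left (norm_nonneg _) ?_)
  refine ContinuousLinearMap.opNorm_le_bound _ zero_le_one fun L => ?_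
  simpa using L.le_opNorm (e i)

theorem norm_iteratedFDeriv_zero_realisation (ω : Ω) :
    ‖iteratedFDeriv ℝ 0 (realisation d f ω) 0‖ = |f ω| := by
  rw [norm_iteratedFDeriv_zero, Real.norm_eq_abs, realisation, zero_vadd]

theorem mem_Ds_of (hf : Measurable f) (hs : ∀ ω, ContDiff ℝ (⊤ : ℕ∞) (realisation d f ω))
    (hb : ∀ n : ℕ, ∃ C : ℝ, ∀ ω, ‖iteratedFDeriv ℝ n (realisation d f ω) 0‖ ≤ C) :
    f ∈ Ds d P := by
  refine ⟨mem_Dw_of hf ?_ (fun i => isWeakPartial_classicalPartial i hf hs) fun i => ?_, hs, hb⟩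
  · obtain ⟨C, hC⟩ := hb 0
    simp only [norm_iteratedFDeriv_zero_realisation] at hC
    exact MemLp.of_bound hf.aestronglyMeasurable C (Eventually.of_forall hC)
  · obtain ⟨C, hC⟩ := hb 1
    refine MemLp.of_bound (isWeakPartial_classicalPartial (P := P) i hf hs).1.aestronglyMeasurable C
      (Eventually.of_forall fun ω => ?_)
    rw [Real.norm_eq_abs, ← norm_iteratedFDeriv_zero_realisation (d := d)]
    exact (norm_iteratedFDeriv_classicalPartial_le i hs 0 ω).trans (hC ω)

theorem exists_bound_of_mem_Ds (hf : f ∈ Ds d P) : ∃ C : ℝ, ∀ ω, |f ω| ≤ C := by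
  simpa only [norm_iteratedFDeriv_zero_realisation] using hf.2.2 0

theorem classicalPartial_mem_Ds (hf : f ∈ Ds d P) (i : Fin d) : classicalPartial i f ∈ Ds d P := by
  refine mem_Ds_of (isWeakPartial_classicalPartial (P := P) i hf.1.1 hf.2.1).1 (fun ω => ?_)
    fun n => ?_
  · rw [realisation_classicalPartial]
    exact contDiff_partial (hf.2.1 ω) _
  · obtain ⟨C, hC⟩ := hf.2.2 (n + 1)
    exact ⟨C, fun ω => (norm_iteratedFDeriv_classicalPartial_le i hf.2.1 n ω).trans (hC ω)⟩

theorem const_mem_Ds (c : ℝ) : (fun _ : Ω => c) ∈ Ds d P := by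
  refine mem_Ds_of measurable_const (fun ω => contDiff_const) fun n => ?_
  refine ⟨‖iteratedFDeriv ℝ n (fun _ : E d => c) 0‖, fun ω => le_rfl⟩

theorem add_mem_Ds {g : Ω → ℝ} (hf : f ∈ Ds d P) (hg : g ∈ Ds d P) : f + g ∈ Ds d P := by
  refine mem_Ds_of (hf.1.1.add hg.1.1) (fun ω => (hf.2.1 ω).add (hg.2.1 ω)) fun n => ?_
  obtain ⟨C, hC⟩ := hf.2.2 n
  obtain ⟨C', hC'⟩ := hg.2.2 n
  refine ⟨C + C', fun ω => ?_⟩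
  have : realisation d (f + g) ω = realisation d f ω + realisation d g ω := rfl
  rw [this, iteratedFDeriv_add_apply ((hf.2.1 ω).of_le (by exact_mod_cast le_top)).contDiffAt
    ((hg.2.1 ω).of_le (by exact_mod_cast le_top)).contDiffAt]
  exact (norm_add_le _ _).trans (add_le_add (hC ω) (hC' ω))

theorem const_smul_mem_Ds (hf : f ∈ Ds d P) (c : ℝ) : c • f ∈ Ds d P := by
  refine mem_Ds_of (hf.1.1.const_smul c) (fun ω => (hf.2.1 ω).const_smul c) fun n => ?_
  obtain ⟨C, hC⟩ := hf.2.2 n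
  refine ⟨|c| * C, fun ω => ?_⟩
  have : realisation d (c • f) ω = c • realisation d f ω := rfl
  rw [this, iteratedFDeriv_const_smul_apply
    ((hf.2.1 ω).of_le (by exact_mod_cast le_top)).contDiffAt, norm_smul]
  exact mul_le_mul_of_nonneg_left (hC ω) (abs_nonneg c)

theorem classicalPartial_add {g : Ω → ℝ} (hf : f ∈ Ds d P) (hg : g ∈ Ds d P) (i : Fin d) :
    classicalPartial i (f + g) = classicalPartial i f + classicalPartial i g := by
  ext ω
  have : realisation d (f + g) ω = realisation d f ω + realisation d g ω := rfl
  simp only [classicalPartial, Pi.add_apply]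
  rw [this, fderiv_add ((hf.2.1 ω).differentiable (by simp) 0)
    ((hg.2.1 ω).differentiable (by simp) 0)]
  rfl

theorem classicalPartial_const_smul (f : Ω → ℝ) (c : ℝ) (i : Fin d) :
    classicalPartial i (c • f) = c • classicalPartial i f := by
  ext ω
  have : realisation d (c • f) ω = c • realisation d f ω := rfl
  simp only [classicalPartial, Pi.smul_apply]
  rw [this, fderiv_const_smul_field]
  rfl

theorem classicalPartial_comm (hf : f ∈ Ds d P) (i j : Fin d) :
    classicalPartial i (classicalPartial j f) = classicalPartial j (classicalPartial i f) := by
  ext ω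
  have key : ∀ k l : Fin d, classicalPartial k (classicalPartial l f) ω =
      fderiv ℝ (fderiv ℝ (realisation d f ω)) 0 (e k) (e l) := by
    intro k l
    rw [classicalPartial, realisation_classicalPartial]
    have h : DifferentiableAt ℝ (fderiv ℝ (realisation d f ω)) 0 :=
      ((hf.2.1 ω).fderiv_right (m := 1) (WithTop.coe_le_coe.2 le_top)).differentiable (by norm_num) 0
    rw [fderiv_clm_apply h (differentiableAt_const _)]
    simp
  rw [key, key]
  have : IsSymmSndFDerivAt ℝ (realisation d f ω) 0 :=
    ((hf.2.1 ω).contDiffAt).isSymmSndFDerivAt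
      (by simpa using WithTop.coe_le_coe.2 (le_top : (2 : ℕ∞) ≤ ⊤))
  exact this _ _

/-- Mollifications of bounded functions belong to `𝔻_s`. -/
theorem mollify_mem_Ds (hf : Measurable f) {M : ℝ} (hM : ∀ ω, |f ω| ≤ M) {K : E d → ℝ}
    (hK : ContDiff ℝ (⊤ : ℕ∞) K) (hc : HasCompactSupport K) : mollify K f ∈ Ds d P := by
  have hli : ∀ ω, LocallyIntegrable (realisation d f ω) volume := fun ω =>
    (memLp_top_of_bound (measurable_realisation hf ω).aestronglyMeasurable M
      (Eventually.of_forall fun x => hM _)).locallyIntegrable le_top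
  refine mem_Ds_of (measurable_mollify hK.continuous.measurable hf) (fun ω => ?_) fun n => ?_
  · rw [realisation_mollify]
    exact contDiff_convolution hK hc (hli ω)
  · obtain ⟨C, hC⟩ := exists_bound_iteratedFDeriv_convolution n ℝ ℝ
      (ContinuousLinearMap.lsmul ℝ ℝ) K hK hc M
    refine ⟨C, fun ω => ?_⟩
    rw [realisation_mollify]
    exact hC _ (hli ω) (fun x => hM _) 0

theorem classicalPartial_mollify (hf : f ∈ Ds d P) {K : E d → ℝ}
    (hK : ContDiff ℝ (⊤ : ℕ∞) K) (hc : HasCompactSupport K) (i : Fin d) :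
    classicalPartial i (mollify K f) = mollify K (classicalPartial i f) := by
  ext ω
  have h := (isEuclideanWeakPartial_of_contDiff i ((hf.2.1 ω).of_le (by exact_mod_cast le_top)))
  have h1 := h.fderiv_convolution hK hc 0
  rw [← realisation_classicalPartial, ← realisation_mollify, ← realisation_mollify] at h1
  rw [classicalPartial, h1, realisation, zero_vadd]

theorem classicalPartial_mollify' (hf : f ∈ Ds d P) {K : E d → ℝ}
    (hK : ContDiff ℝ (⊤ : ℕ∞) K) (hc : HasCompactSupport K) (i : Fin d) :
    classicalPartial i (mollify K f) = mollify (fun t => fderiv ℝ K t (e i)) f := by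
  ext ω
  rw [classicalPartial, realisation_mollify, fderiv_convolution_apply hK hc
    (hf.2.1 ω).continuous.locallyIntegrable, ← realisation_mollify, realisation, zero_vadd]

end Ds

end

section

variable {d : ℕ} {Ω : Type*} [MeasurableSpace Ω] [AddAction (E d) Ω] [MeasurableVAdd₂ (E d) Ω]
  {P : Measure Ω} [IsProbabilityMeasure P] [VAddInvariantMeasure (E d) Ω P]

/-! ### Density of `𝔻_s` in `L²` and in `𝔻_w` -/

theorem mollify_kernel_mem_Ds {f : Ω → ℝ} (hf : Measurable f) {M : ℝ} (hM : ∀ ω, |f ω| ≤ M)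
    (n : ℕ) : mollify (kernel d n) f ∈ Ds d P :=
  mollify_mem_Ds hf hM (contDiff_kernel n) (hasCompactSupport_kernel n)

theorem mollify_softTrunc_mem_Ds {f : Ω → ℝ} (hf : Measurable f) (m n : ℕ) :
    mollify (kernel d n) (softTrunc m ∘ f) ∈ Ds d P :=
  mollify_kernel_mem_Ds ((measurable_softTrunc m).comp hf) (fun ω => abs_softTrunc_le m (f ω)) n

theorem exists_mem_Ds_eLpNorm_sub_lt {f : Ω → ℝ} (hf : Measurable f) (hf2 : MemLp f 2 P)
    {ε : ℝ≥0∞} (hε : 0 < ε) : ∃ h ∈ Ds d P, eLpNorm (h - f) 2 P < ε := by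
  have hε2 : 0 < ε / 2 := ENNReal.div_pos hε.ne' (by norm_num)
  obtain ⟨m, hm⟩ := ((tendsto_eLpNorm_softTrunc hf hf2).eventually (gt_mem_nhds hε2)).exists
  have hb : Measurable (softTrunc m ∘ f) := (measurable_softTrunc m).comp hf
  have hb2 : MemLp (softTrunc m ∘ f) 2 P := memLp_softTrunc_comp m hf
  obtain ⟨n, hn⟩ := ((tendsto_eLpNorm_mollify_kernel (d := d) hb hb2).eventually
    (gt_mem_nhds hε2)).exists
  refine ⟨_, mollify_softTrunc_mem_Ds hf m n, ?_⟩
  rw [← sub_add_sub_cancel _ (softTrunc m ∘ f)]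
  refine (eLpNorm_add_le ((measurable_mollify (measurable_kernel n) hb).aestronglyMeasurable.sub
    hb2.1) (hb2.1.sub hf2.1) (by norm_num)).trans_lt ?_
  exact (ENNReal.add_lt_add hn hm).trans_eq (ENNReal.add_halves ε)

theorem dense_Ds : Dense {F : Lp ℝ 2 P | ∃ f ∈ Ds d P, F =ᵐ[P] f} := by
  rw [EMetric.dense_iff]
  intro F ε hε
  have hm : AEStronglyMeasurable F P := Lp.aestronglyMeasurable F
  obtain ⟨f, hf, hFf⟩ : ∃ f : Ω → ℝ, Measurable f ∧ F =ᵐ[P] f :=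
    ⟨hm.mk F, hm.stronglyMeasurable_mk.measurable, hm.ae_eq_mk⟩
  have hf2 : MemLp f 2 P := (memLp_congr_ae hFf).1 (Lp.memLp F)
  obtain ⟨h, hh, hlt⟩ := exists_mem_Ds_eLpNorm_sub_lt (d := d) hf hf2 hε
  refine ⟨hh.1.2.1.toLp h, ?_, h, hh, hh.1.2.1.coeFn_toLp⟩
  rw [Metric.mem_eball, Lp.edist_def]
  refine (eLpNorm_congr_ae ?_).trans_lt hlt
  exact hh.1.2.1.coeFn_toLp.sub hFf

theorem gradNorm_sub_le {f h k : Ω → ℝ} (hf : f ∈ Dw d P) (hh : h ∈ Dw d P) (hk : k ∈ Dw d P) :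
    gradNorm d P (f - k) ≤ gradNorm d P (f - h) + gradNorm d P (h - k) := by
  have h1 := isWeakPartial_of_mem_Dw hf
  have h2 := isWeakPartial_of_mem_Dw hh
  have h3 := isWeakPartial_of_mem_Dw hk
  rw [gradNorm_eq fun i => (h1 i).sub (h3 i), gradNorm_eq fun i => (h1 i).sub (h2 i),
    gradNorm_eq fun i => (h2 i).sub (h3 i), add_add_add_comm, ← Finset.sum_add_distrib]
  refine add_le_add ?_ (Finset.sum_le_sum fun i _ => ?_)
  · rw [← sub_add_sub_cancel f h k]
    exact eLpNorm_add_le (hf.2.1.sub hh.2.1).1 (hh.2.1.sub hk.2.1).1 (by norm_num)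
  · rw [← sub_add_sub_cancel (weakPartial P i f) (weakPartial P i h)]
    exact eLpNorm_add_le ((hf.2.2 i).2.2.2.sub (hh.2.2 i).2.2.2).1
      ((hh.2.2 i).2.2.2.sub (hk.2.2 i).2.2.2).1 (by norm_num)

theorem tendsto_gradNorm_sub {f : Ω → ℝ} {fn : ℕ → Ω → ℝ} {g : Fin d → Ω → ℝ}
    {gn : ℕ → Fin d → Ω → ℝ} (hg : ∀ i, IsWeakPartial P i f (g i))
    (hgn : ∀ n i, IsWeakPartial P i (fn n) (gn n i))
    (h : Tendsto (fun n => eLpNorm (fn n - f) 2 P) atTop (𝓝 0))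
    (h' : ∀ i, Tendsto (fun n => eLpNorm (gn n i - g i) 2 P) atTop (𝓝 0)) :
    Tendsto (fun n => gradNorm d P (fn n - f)) atTop (𝓝 0) := by
  simp only [gradNorm_eq fun i => (hgn _ i).sub (hg i)]
  simpa using h.add (tendsto_finsetSum Finset.univ fun i _ => h' i)

theorem mollify_kernel_mem_Dw {f : Ω → ℝ} (hf : f ∈ Dw d P) (n : ℕ) :
    mollify (kernel d n) f ∈ Dw d P :=
  mem_Dw_of (measurable_mollify (measurable_kernel n) hf.1)
    (memLp_mollify (measurable_kernel n) (integrable_kernel n) hf.1 hf.2.1)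
    (fun i => (isWeakPartial_of_mem_Dw hf i).mollify (contDiff_kernel n)
      (hasCompactSupport_kernel n))
    (fun i => memLp_mollify (measurable_kernel n) (integrable_kernel n)
      (isWeakPartial_of_mem_Dw hf i).1 (hf.2.2 i).2.2.2)

theorem tendsto_gradNorm_mollify_kernel {f : Ω → ℝ} (hf : f ∈ Dw d P) :
    Tendsto (fun n => gradNorm d P (mollify (kernel d n) f - f)) atTop (𝓝 0) :=
  tendsto_gradNorm_sub (isWeakPartial_of_mem_Dw hf)
    (fun n i => (isWeakPartial_of_mem_Dw hf i).mollify (contDiff_kernel n)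
      (hasCompactSupport_kernel n))
    (tendsto_eLpNorm_mollify_kernel hf.1 hf.2.1)
    (fun i => tendsto_eLpNorm_mollify_kernel (isWeakPartial_of_mem_Dw hf i).1
      (hf.2.2 i).2.2.2)

/-- The chain rule for soft truncation of functions with smooth realisations. -/
theorem isWeakPartial_softTrunc {i : Fin d} {f g : Ω → ℝ} (hf : Measurable f)
    (hg : Measurable g) (h : ∀ᵐ ω ∂P, ContDiff ℝ 1 (realisation d f ω) ∧
      realisation d g ω = fun x => fderiv ℝ (realisation d f ω) x (e i)) (m : ℕ) :
    IsWeakPartial P i (softTrunc m ∘ f)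
      (fun ω => 1 / (1 + (f ω / ((m : ℝ) + 1)) ^ 2) * g ω) := by
  refine isWeakPartial_of_ae_smooth i (by fun_prop) ?_
  filter_upwards [h] with ω hω
  have e1 : realisation d (softTrunc m ∘ f) ω = softTrunc m ∘ realisation d f ω := rfl
  refine ⟨e1 ▸ ((contDiff_softTrunc m).of_le (by exact_mod_cast le_top)).comp hω.1, ?_⟩
  ext x
  have h1 := ((hasDerivAt_softTrunc m (realisation d f ω x)).comp_hasFDerivAt x
    (hω.1.differentiable (by norm_num) x).hasFDerivAt).fderiv
  have h2 := congrFun hω.2 x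
  rw [e1, h1, smul_apply, ← h2]
  rfl

/-- The first mollification makes the chain rule classical, the truncation makes the function
bounded, and the second mollification returns a bounded function to `Ds`. -/
theorem exists_mem_Ds_gradNorm_sub_lt {f : Ω → ℝ} (hf : f ∈ Dw d P) {ε : ℝ≥0∞} (hε : 0 < ε) :
    ∃ h ∈ Ds d P, gradNorm d P (h - f) < ε := by
  have hε2 : 0 < ε / 2 := ENNReal.div_pos hε.ne' (by norm_num)
  have hε4 : 0 < ε / 2 / 2 := ENNReal.div_pos hε2.ne' (by norm_num)
  obtain ⟨n, hn⟩ := ((tendsto_gradNorm_mollify_kernel hf).eventually (gt_mem_nhds hε2)).exists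
  have hu := mollify_kernel_mem_Dw hf n
  have hsm := fun i => (isWeakPartial_of_mem_Dw hf i).mollify_smooth (contDiff_kernel n)
    (hasCompactSupport_kernel n)
  have hw := fun i => (isWeakPartial_of_mem_Dw hf i).mollify (contDiff_kernel n)
    (hasCompactSupport_kernel n)
  have hw2 := fun i => memLp_mollify (d := d) (P := P) (measurable_kernel n) (integrable_kernel n)
      (isWeakPartial_of_mem_Dw hf i).1 (hf.2.2 i).2.2.2
  set u := mollify (kernel d n) f
  have ht := fun m i => isWeakPartial_softTrunc hu.1 (hw i).1 (hsm i) m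
  obtain ⟨m, hm⟩ := ((tendsto_gradNorm_sub hw ht (tendsto_eLpNorm_softTrunc hu.1 hu.2.1)
    (fun i => tendsto_eLpNorm_deriv_softTrunc_mul hu.1 (hw i).1 (hw2 i))).eventually
    (gt_mem_nhds hε4)).exists
  have hv : softTrunc m ∘ u ∈ Dw d P := by
    refine mem_Dw_of ((measurable_softTrunc m).comp hu.1) (memLp_softTrunc_comp m hu.1) (ht m)
      fun i => (hw2 i).mono (ht m i).1.aestronglyMeasurable (Eventually.of_forall fun ω => ?_)
    rw [norm_mul]
    exact mul_le_of_le_one_left (norm_nonneg _) (abs_deriv_softTrunc_le m _)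
  obtain ⟨k, hk⟩ := ((tendsto_gradNorm_mollify_kernel hv).eventually (gt_mem_nhds hε4)).exists
  have hD : mollify (kernel d k) (softTrunc m ∘ u) ∈ Ds d P := mollify_softTrunc_mem_Ds hu.1 m k
  refine ⟨_, hD, ?_⟩
  calc _ ≤ _ := gradNorm_sub_le hD.1 hu hf
    _ ≤ _ := add_le_add (gradNorm_sub_le hD.1 hv hu) le_rfl
    _ < ε / 2 / 2 + ε / 2 / 2 + ε / 2 := ENNReal.add_lt_add (ENNReal.add_lt_add hk hm) hn
    _ = ε := by rw [ENNReal.add_halves, ENNReal.add_halves]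

theorem Ds_mem_frakD : Ds d P ∈ frakD d P :=
  ⟨fun _ hf => hf.1, fun _ hf _ hε => exists_mem_Ds_gradNorm_sub_lt hf hε⟩

/-! ### Densities -/

theorem Fs_subset_Fw : Fs d P ⊆ Fw d P := by
  rintro f ⟨hf, h1, c, hc, hcf⟩
  refine ⟨hf.1, h1, ⟨c, hc, Eventually.of_forall hcf⟩, ?_, fun i => ?_⟩
  · obtain ⟨C, hC⟩ := exists_bound_of_mem_Ds hf
    exact (memLp_top_of_bound hf.1.1.aestronglyMeasurable C (Eventually.of_forall hC)).2
  · have h2 := isWeakPartial_classicalPartial (P := P) i hf.1.1 hf.2.1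
    rw [eLpNorm_congr_ae (weakPartial_ae_eq h2)]
    obtain ⟨C, hC⟩ := exists_bound_of_mem_Ds (classicalPartial_mem_Ds hf i)
    exact (memLp_top_of_bound h2.1.aestronglyMeasurable C (Eventually.of_forall hC)).2

theorem Fs_mem_frakF : Fs d P ∈ frakF d P := by
  refine ⟨Fs_subset_Fw, ?_⟩
  rintro f ⟨hf, h1, ⟨c, hc, hcf⟩, htop, -⟩
  obtain ⟨M, hM⟩ : ∃ M : ℝ, ∀ᵐ ω ∂P, |f ω| ≤ M := by
    refine ⟨(eLpNorm f ∞ P).toReal, ?_⟩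
    filter_upwards [ae_le_eLpNormEssSup (f := f) (μ := P)] with ω hω
    rw [← eLpNorm_exponent_top] at hω
    simpa using ENNReal.toReal_mono htop.ne hω
  -- a version of `f` that is bounded and bounded away from zero at every point
  set f' : Ω → ℝ := fun ω => max c (min (f ω) (max M c)) with hf'
  have hff' : f =ᵐ[P] f' := by
    filter_upwards [hcf, hM] with ω a b
    simp only [hf']
    rw [min_eq_left (((le_abs_self _).trans b).trans (le_max_left _ _)), max_eq_right a.le]
  have hf'm : Measurable f' := measurable_const.max (hf.1.min measurable_const)
  have hf'c : ∀ ω, c ≤ f' ω := fun ω => le_max_left _ _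
  have hf'M : ∀ ω, |f' ω| ≤ max M c := fun ω => by
    rw [abs_of_nonneg (hc.le.trans (hf'c ω))]
    exact max_le (le_max_right _ _) (min_le_right _ _)
  have hf'w : f' ∈ Dw d P := mem_Dw_of hf'm ((memLp_congr_ae hff').1 hf.2.1)
    (fun i => (isWeakPartial_of_mem_Dw hf i).congr hff') (fun i => (hf.2.2 i).2.2.2)
  have hge : ∀ n ω, c ≤ mollify (kernel d n) f' ω := fun n ω =>
    le_mollify_kernel n hf'm hf'M hf'c ω
  -- Mollification preserves only the weak bound `c ≤ f'`; halving `c` gives the strict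
  -- inequalities, uniformly in `n`.
  refine ⟨fun n => mollify (kernel d n) f', c / 2, fun n => ⟨?_, ?_, c / 2, by positivity, ?_⟩,
    by positivity, ?_, Eventually.of_forall fun ω => ?_⟩
  · exact mollify_kernel_mem_Ds hf'm hf'M n
  · rw [integral_mollify_kernel n hf'm (hf'w.2.1.integrable (by norm_num)), ← h1]
    exact integral_congr_ae hff'.symm
  · exact fun ω => (half_lt_self hc).trans_le (hge n ω)
  · refine tendsto_gradNorm_sub (isWeakPartial_of_mem_Dw hf)
      (fun n i => ((isWeakPartial_of_mem_Dw hf i).congr hff').mollify (contDiff_kernel n)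
        (hasCompactSupport_kernel n)) ?_
      (fun i => tendsto_eLpNorm_mollify_kernel (isWeakPartial_of_mem_Dw hf i).1
        (hf.2.2 i).2.2.2)
    refine (tendsto_eLpNorm_mollify_kernel (d := d) hf'm hf'w.2.1).congr fun n => ?_
    exact eLpNorm_congr_ae ((ae_eq_refl _).sub hff'.symm)
  · exact (half_lt_self hc).trans_le (le_ciInf fun n => hge n ω)

end

section

variable {d : ℕ} {Ω : Type*} [MeasurableSpace Ω] [AddAction (E d) Ω] [MeasurableVAdd₂ (E d) Ω]
  {P : Measure Ω} [IsProbabilityMeasure P] [VAddInvariantMeasure (E d) Ω P]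

/-! ### Integration by parts on `Ω` -/

/-- Each difference quotient has mean zero by invariance, and the mean value inequality along the
orbit dominates it by `C`. -/
theorem integral_classicalPartial_eq_zero_of_bounded (i : Fin d) {v : Ω → ℝ} (hv : Measurable v)
    {M : ℝ} (hM : ∀ ω, |v ω| ≤ M) (hd : ∀ ω, Differentiable ℝ (realisation d v ω)) {C : ℝ}
    (hC : ∀ ω, |classicalPartial i v ω| ≤ C) : ∫ ω, classicalPartial i v ω ∂P = 0 := by
  have hvi : Integrable v P := Integrable.of_bound hv.aestronglyMeasurable M
    (Eventually.of_forall hM)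
  have hbound : ∀ (t : ℝ) (ω : Ω), |v ((t • (e i : E d)) +ᵥ ω) - v ω| ≤ C * |t| := by
    intro t ω
    have hg : ∀ s : ℝ, HasDerivAt (fun s : ℝ => realisation d v ω (s • (e i : E d)))
        (classicalPartial i v ((s • (e i : E d)) +ᵥ ω)) s := by
      intro s
      have h1 : HasDerivAt (fun s : ℝ => s • (e i : E d)) (e i) s := by
        simpa using (hasDerivAt_id s).smul_const (e i : E d)
      have h2 := (hd ω (s • (e i : E d))).hasFDerivAt.comp_hasDerivAt s h1
      have h3 := congrFun (realisation_classicalPartial i v ω) (s • (e i : E d))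
      exact h2.congr_deriv h3.symm
    have := (convex_univ (𝕜 := ℝ) (E := ℝ)).norm_image_sub_le_of_norm_hasDerivWithin_le
      (C := C) (x := 0) (y := t) (fun x _ => (hg x).hasDerivWithinAt)
      (fun x _ => hC _) trivial trivial
    simpa [realisation] using this
  have hlim : Tendsto (fun n : ℕ => ∫ ω, ((n : ℝ) + 1) *
      (v (((1 / ((n : ℝ) + 1)) • (e i : E d)) +ᵥ ω) - v ω) ∂P) atTop
      (𝓝 (∫ ω, classicalPartial i v ω ∂P)) := by
    refine tendsto_integral_of_dominated_convergence (fun _ => C)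
      (fun n => (((hv.comp (measurable_const_vadd _)).sub hv).const_mul _).aestronglyMeasurable)
      (integrable_const _) (fun n => Eventually.of_forall fun ω => ?_)
      (Eventually.of_forall fun ω => tendsto_classicalPartial i (hd ω 0))
    have hn : (0 : ℝ) < n + 1 := by positivity
    rw [norm_mul, Real.norm_eq_abs, Real.norm_eq_abs, abs_of_pos hn]
    calc _ ≤ ((n : ℝ) + 1) * (C * |1 / ((n : ℝ) + 1)|) := by gcongr; exact hbound _ _
      _ = C := by rw [abs_of_pos (by positivity)]; field_simp
  refine tendsto_nhds_unique hlim (tendsto_const_nhds.congr fun n => ?_)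
  have hvs : Integrable (fun ω => v (((1 / ((n : ℝ) + 1)) • (e i : E d)) +ᵥ ω)) P :=
    (measurePreserving_vadd _ P).integrable_comp_of_integrable hvi
  rw [integral_const_mul, integral_sub hvs hvi, integral_vadd_eq_self v, sub_self, mul_zero]

theorem integrable_of_mem_Ds {f : Ω → ℝ} (hf : f ∈ Ds d P) : Integrable f P :=
  hf.1.2.1.integrable (by norm_num)

theorem integral_classicalPartial_eq_zero {f : Ω → ℝ} (hf : f ∈ Ds d P) (i : Fin d) :
    ∫ ω, classicalPartial i f ω ∂P = 0 := by
  obtain ⟨M, hM⟩ := exists_bound_of_mem_Ds hf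
  obtain ⟨C, hC⟩ := exists_bound_of_mem_Ds (classicalPartial_mem_Ds hf i)
  exact integral_classicalPartial_eq_zero_of_bounded i hf.1.1 hM
    (fun ω => (hf.2.1 ω).differentiable (by simp)) hC

/-- The product rule and the vanishing mean of a derivative. The product only has to be bounded and
differentiable with bounded partial derivative, so its membership in `Ds` is not needed. -/
theorem integral_classicalPartial_mul {w u : Ω → ℝ} (hw : w ∈ Ds d P) (hu : u ∈ Ds d P)
    (i : Fin d) : ∫ ω, classicalPartial i w ω * u ω ∂P =
      - ∫ ω, w ω * classicalPartial i u ω ∂P := by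
  have hw' := classicalPartial_mem_Ds hw i
  have hu' := classicalPartial_mem_Ds hu i
  obtain ⟨A, hA⟩ := exists_bound_of_mem_Ds hw
  obtain ⟨B, hB⟩ := exists_bound_of_mem_Ds hu
  obtain ⟨A', hA'⟩ := exists_bound_of_mem_Ds hw'
  obtain ⟨B', hB'⟩ := exists_bound_of_mem_Ds hu'
  have hdw := fun ω => (hw.2.1 ω).differentiable (by simp)
  have hdu := fun ω => (hu.2.1 ω).differentiable (by simp)
  have hp : ∀ ω, classicalPartial i (fun ω => w ω * u ω) ω =
      classicalPartial i w ω * u ω + w ω * classicalPartial i u ω := by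
    intro ω
    have h1 : realisation d (fun ω => w ω * u ω) ω =
      fun x => realisation d w ω x * realisation d u ω x := rfl
    rw [classicalPartial, h1, fderiv_fun_mul (hdw ω 0) (hdu ω 0)]
    simp [classicalPartial, realisation]
    ring
  have key := integral_classicalPartial_eq_zero_of_bounded (P := P) i
    (v := fun ω => w ω * u ω) (hw.1.1.mul hu.1.1)
    (M := A * B) (fun ω => by
      rw [abs_mul]
      exact mul_le_mul (hA ω) (hB ω) (abs_nonneg _) ((abs_nonneg _).trans (hA ω)))
    (fun ω => (hdw ω).mul (hdu ω)) (C := A' * B + A * B') (fun ω => by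
      rw [hp]
      refine (abs_add_le _ _).trans (add_le_add ?_ ?_) <;> rw [abs_mul]
      · exact mul_le_mul (hA' ω) (hB ω) (abs_nonneg _) ((abs_nonneg _).trans (hA' ω))
      · exact mul_le_mul (hA ω) (hB' ω) (abs_nonneg _) ((abs_nonneg _).trans (hA ω)))
  simp only [hp] at key
  have hadd := integral_add (hw'.1.2.1.integrable_mul hu.1.2.1)
    (hw.1.2.1.integrable_mul hu'.1.2.1)
  simp only [Pi.mul_apply] at hadd
  linarith

/-! ### Functions invariant along almost every orbit -/

/-- The adjoint of mollification by `∂_j K` uses the reflected kernel `-∂_j K`, as `K` is even; that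
derivative then passes to `w`. -/
theorem integral_mollify_partial_mul {f w : Ω → ℝ} (hf : Measurable f) (hfi : Integrable f P)
    (hw : w ∈ Ds d P) (n : ℕ) (j : Fin d) :
    ∫ ω, mollify (fun t => fderiv ℝ (kernel d n) t (e j)) f ω * classicalPartial j w ω ∂P =
      - ∫ ω, classicalPartial j (classicalPartial j (mollify (kernel d n) w)) ω * f ω ∂P := by
  have hK := contDiff_kernel (d := d) n
  have hc := hasCompactSupport_kernel (d := d) n
  have hpc := (contDiff_partial hK (e j)).continuous
  have hw' := classicalPartial_mem_Ds hw j
  obtain ⟨M, hM⟩ := exists_bound_of_mem_Ds hw'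
  rw [integral_mollify_mul hpc.measurable
    (hpc.integrable_of_hasCompactSupport (hasCompactSupport_partial hc _)) hf hfi hw'.1.1 hM,
    classicalPartial_mollify hw hK hc, classicalPartial_mollify' hw' hK hc, ← integral_neg]
  congr 1 with ω
  have hodd : ∀ t, fderiv ℝ (kernel d n) (-t) (e j) = -fderiv ℝ (kernel d n) t (e j) := by
    intro t
    have h1 : (fun x => kernel d n (-x)) = kernel d n := funext (kernel_neg n)
    have h2 := (hK.differentiable (by simp) (-t)).hasFDerivAt.comp t (hasFDerivAt_id t).neg
    simp only [Function.comp_def, h1] at h2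
    rw [h2.fderiv]
    simp
  simp only [mollify, hodd, neg_mul, integral_neg]
  ring

/-- A square integrable function on `Ω` orthogonal to all Laplacians is constant along almost
every orbit. -/
theorem ae_ae_eq_of_integral_laplacian_eq_zero {f : Ω → ℝ} (hf : Measurable f)
    (hf2 : MemLp f 2 P)
    (h : ∀ w ∈ Ds d P, ∑ j : Fin d, ∫ ω, classicalPartial j (classicalPartial j w) ω * f ω ∂P = 0) :
    ∀ᵐ ω ∂P, ∀ᵐ x : E d, f (x +ᵥ ω) = f ω := by
  have hfi : Integrable f P := hf2.integrable (by norm_num)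
  have hconst : ∀ n : ℕ, ∀ᵐ ω ∂P, ∀ x : E d,
      mollify (kernel d n) f (x +ᵥ ω) = mollify (kernel d n) f ω := by
    intro n
    have hK := contDiff_kernel (d := d) n
    have hc := hasCompactSupport_kernel (d := d) n
    have hpc := fun j : Fin d => (contDiff_partial hK (e j)).continuous
    set F := mollify (kernel d n) f with hF
    set G : Fin d → Ω → ℝ := fun j => mollify (fun t => fderiv ℝ (kernel d n) t (e j)) f with hG
    have hFm : Measurable F := measurable_mollify (measurable_kernel n) hf
    have hGm : ∀ j, Measurable (G j) := fun j => measurable_mollify (hpc j).measurable hf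
    have hF2 : MemLp F 2 P := memLp_mollify (measurable_kernel n) (integrable_kernel n) hf hf2
    have hG2 : ∀ j, MemLp (G j) 2 P := fun j => memLp_mollify (hpc j).measurable
      ((hpc j).integrable_of_hasCompactSupport (hasCompactSupport_partial hc _)) hf hf2
    have hsm := fun j : Fin d => ae_smooth_mollify (P := P) (i := j) hf hfi hK hc
    have hw : ∀ j, IsWeakPartial P j F (G j) := fun j =>
      isWeakPartial_of_ae_smooth j (hGm j) (hsm j)
    have hFD : F ∈ Dw d P := mem_Dw_of hFm hF2 hw hG2
    -- The hypothesis is applied to the mollified test function, so `G` is orthogonal to every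
    -- gradient from `Ds`.
    have horth : ∀ w ∈ Ds d P, ∑ j, ∫ ω, G j ω * classicalPartial j w ω ∂P = 0 := by
      intro w hwD
      obtain ⟨M, hM⟩ := exists_bound_of_mem_Ds hwD
      simp only [hG, integral_mollify_partial_mul hf hfi hwD n, Finset.sum_neg_distrib]
      rw [h _ (mollify_kernel_mem_Ds hwD.1.1 hM n), neg_zero]
    have happ : ∀ k : ℕ, ∃ w ∈ Ds d P, gradNorm d P (w - F) < ((k : ℝ≥0∞) + 1)⁻¹ := fun k =>
      exists_mem_Ds_gradNorm_sub_lt hFD (by simp)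
    choose w hwD hwlt using happ
    have hw0 : Tendsto (fun k => gradNorm d P (w k - F)) atTop (𝓝 0) := by
      refine tendsto_of_tendsto_of_tendsto_of_le_of_le tendsto_const_nhds
        ?_ (fun _ => zero_le) (fun k => (hwlt k).le)
      have := (tendsto_add_atTop_iff_nat 1).2 ENNReal.tendsto_inv_nat_nhds_zero
      simpa using this
    have hpart : ∀ j, Tendsto (fun k => eLpNorm (classicalPartial j (w k) - G j) 2 P) atTop
        (𝓝 0) := by
      intro j
      refine tendsto_of_tendsto_of_tendsto_of_le_of_le tendsto_const_nhds hw0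
        (fun _ => zero_le) (fun k => ?_)
      simp only
      rw [gradNorm_eq fun i =>
        (isWeakPartial_classicalPartial i (hwD k).1.1 (hwD k).2.1).sub (hw i)]
      exact (Finset.single_le_sum (f := fun i => eLpNorm (classicalPartial i (w k) - G i) 2 P)
        (fun _ _ => zero_le) (Finset.mem_univ j)).trans le_add_self
    -- The gradients of the `w k` converge to `G` in `L²`, so `G` is orthogonal to itself.
    have hsum : ∑ j, ∫ ω, G j ω * G j ω ∂P = 0 := by
      have h1 := tendsto_finsetSum Finset.univ fun j (_ : j ∈ Finset.univ) =>
        tendsto_integral_mul (fun k => (classicalPartial_mem_Ds (hwD k) j).1.2.1) (hG2 j) (hG2 j)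
          (hpart j)
      simp only [horth _ (hwD _)] at h1
      exact tendsto_nhds_unique h1 tendsto_const_nhds
    have hG0 : ∀ j, ∀ᵐ ω ∂P, G j ω = 0 := by
      intro j
      have h1 := (Finset.sum_eq_zero_iff_of_nonneg fun j _ =>
        integral_nonneg fun ω => mul_self_nonneg (G j ω)).1 hsum j (Finset.mem_univ j)
      rw [integral_eq_zero_iff_of_nonneg (fun ω => mul_self_nonneg (G j ω))
        ((hG2 j).integrable_mul (hG2 j))] at h1
      filter_upwards [h1] with ω hω
      simpa using hω
    have hall : ∀ᵐ ω ∂P, ∀ j : Fin d, ContDiff ℝ 1 (realisation d F ω) ∧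
        (realisation d (G j) ω = fun x => fderiv ℝ (realisation d F ω) x (e j)) ∧
        ∀ᵐ x : E d, G j (x +ᵥ ω) = 0 := by
      rw [ae_all_iff]
      intro j
      filter_upwards [hsm j, ae_ae_vadd (d := d) (hG0 j)] with ω h1 h2
      exact ⟨h1.1, h1.2, h2⟩
    filter_upwards [hall, ae_locallyIntegrable_realisation (d := d) hf hfi] with ω hω hli x
    have hC1 : ContDiff ℝ 1 (realisation d F ω) := by
      rw [hF, realisation_mollify]
      exact (contDiff_convolution hK hc hli).of_le (by exact_mod_cast le_top)
    have hzero : ∀ y, fderiv ℝ (realisation d F ω) y = 0 := by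
      intro y
      have hb : ∀ j, fderiv ℝ (realisation d F ω) y (e j) = 0 := by
        intro j
        -- A continuous derivative vanishing almost everywhere on the orbit vanishes at every point
        -- of it.
        have h1 : (fun y => fderiv ℝ (realisation d F ω) y (e j)) = fun _ => 0 := by
          refine Measure.eq_of_ae_eq (μ := volume) ?_
            ((hC1.continuous_fderiv (by norm_num)).clm_apply continuous_const) continuous_const
          rw [← (hω j).2.1]
          exact (hω j).2.2
        exact congrFun h1 y
      refine ContinuousLinearMap.coe_injective
        ((EuclideanSpace.basisFun (Fin d) ℝ).toBasis.ext fun j => ?_)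
      simpa using hb j
    have := is_const_of_fderiv_eq_zero (hC1.differentiable (by norm_num)) hzero x 0
    simpa [realisation] using this
  -- The mollifications agree at `ω` and `x +ᵥ ω` for every `n`; their limits are `f ω` and `f (x +ᵥ
  -- ω)`.
  filter_upwards [ae_all_iff.2 hconst, ae_locallyIntegrable_realisation (d := d) hf hfi,
    ae_tendsto_mollify_kernel (d := d) hf hfi] with ω h1 h2 h3
  filter_upwards [tendsto_mollify_kernel_of_locallyIntegrable h2] with x hx
  simp only [h1] at hx
  exact tendsto_nhds_unique hx h3

/-- A bounded function that is constant along almost every orbit has a version that is invariant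
at every point. -/
theorem exists_invariant_version {b : Ω → ℝ} (hb : Measurable b) {M : ℝ} (hM : ∀ ω, |b ω| ≤ M)
    (h : ∀ᵐ ω ∂P, ∀ᵐ x : E d, b (x +ᵥ ω) = b ω) :
    ∃ g : Ω → ℝ, Measurable g ∧ (∃ C, ∀ ω, |g ω| ≤ C) ∧ g =ᵐ[P] b ∧
      ∀ (x : E d) (ω : Ω), g (x +ᵥ ω) = g ω := by
  -- A probability measure with the Lebesgue null sets, so that `m` is an orbit average equal to the
  -- almost everywhere constant value when there is one.
  set γ : Measure (E d) := (volume : Measure (E d)).toFinite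
  have hγ : ae γ = ae (volume : Measure (E d)) := ae_toFinite
  have hbm := measurable_realisation_uncurry (d := d) hb
  set m : Ω → ℝ := fun ω => ∫ x, realisation d b ω x ∂γ with hm
  have hmm : Measurable m := hbm.stronglyMeasurable.integral_prod_right.measurable
  -- The points on whose orbit `b` is almost everywhere constant. Translations preserve null sets,
  -- so `A` is invariant and so is `m` on it; cutting off to zero outside `A` gives invariance at
  -- every point.
  set A : Set Ω := {ω | ∫⁻ x, ‖realisation d b ω x - m ω‖ₑ ∂γ = 0} with hA
  have hAm : MeasurableSet A :=
    (hbm.sub (hmm.comp measurable_fst)).enorm.lintegral_prod_right' (measurableSet_singleton 0)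
  have hmemA : ∀ ω, ω ∈ A ↔ ∀ᵐ x : E d, b (x +ᵥ ω) = m ω := by
    intro ω
    have h1 : Measurable fun x => ‖realisation d b ω x - m ω‖ₑ :=
      ((measurable_realisation hb ω).sub_const _).enorm
    rw [hA, Set.mem_ofPred_eq, lintegral_eq_zero_iff h1, EventuallyEq, hγ]
    refine eventually_congr (Eventually.of_forall fun x => ?_)
    simp [realisation, sub_eq_zero]
  have hmean : ∀ (ω : Ω) (c : ℝ), (∀ᵐ x : E d, b (x +ᵥ ω) = c) → m ω = c := by
    intro ω c hc
    have : realisation d b ω =ᵐ[γ] fun _ => c := by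
      rw [EventuallyEq, hγ]
      exact hc
    rw [hm]
    simp only
    rw [integral_congr_ae this]
    simp
  have hshift : ∀ (x : E d) (ω : Ω), ω ∈ A → x +ᵥ ω ∈ A ∧ m (x +ᵥ ω) = m ω := by
    intro x ω hω
    have h1 : ∀ᵐ y : E d, b (y +ᵥ x +ᵥ ω) = m ω := by
      have := (measurePreserving_add_right (volume : Measure (E d)) x).quasiMeasurePreserving.ae
        ((hmemA ω).1 hω)
      simpa only [add_vadd] using this
    have h2 := hmean _ _ h1
    refine ⟨(hmemA _).2 ?_, h2⟩
    rw [h2]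
    exact h1
  refine ⟨A.indicator m, hmm.indicator hAm, ⟨M * γ.real Set.univ, fun ω => ?_⟩, ?_,
    fun x ω => ?_⟩
  · have h1 : ‖m ω‖ ≤ M * γ.real Set.univ :=
      norm_integral_le_of_norm_le_const (Eventually.of_forall fun x => hM _)
    rw [← Real.norm_eq_abs]
    exact (norm_indicator_le_norm_self _ _).trans h1
  · filter_upwards [h] with ω hω
    have h1 := hmean ω _ hω
    rw [Set.indicator_of_mem ((hmemA ω).2 (by rwa [h1])), h1]
  · by_cases hω : ω ∈ A
    · rw [Set.indicator_of_mem hω, Set.indicator_of_mem (hshift x ω hω).1, (hshift x ω hω).2]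
    · have : x +ᵥ ω ∉ A := fun hx => hω (by simpa using (hshift (-x) _ hx).1)
      rw [Set.indicator_of_notMem hω, Set.indicator_of_notMem this]

theorem invariant_mem_Ds {g : Ω → ℝ} (hg : Measurable g) {C : ℝ} (hC : ∀ ω, |g ω| ≤ C)
    (hinv : ∀ (x : E d) (ω : Ω), g (x +ᵥ ω) = g ω) : g ∈ Ds d P := by
  have hr : ∀ ω, realisation d g ω = fun _ => g ω := fun ω => funext fun x => hinv x ω
  refine mem_Ds_of hg (fun ω => hr ω ▸ contDiff_const) fun n => ?_
  cases n with
  | zero => exact ⟨C, fun ω => by simpa only [norm_iteratedFDeriv_zero_realisation] using hC ω⟩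
  | succ n => exact ⟨0, fun ω => by rw [hr, iteratedFDeriv_succ_const]; simp⟩

theorem classicalPartial_invariant {g : Ω → ℝ}
    (hinv : ∀ (x : E d) (ω : Ω), g (x +ᵥ ω) = g ω) (i : Fin d) : classicalPartial i g = 0 := by
  ext ω
  have hr : realisation d g ω = fun _ => g ω := funext fun x => hinv x ω
  simp [classicalPartial, hr]

end

section

variable {d : ℕ} {Ω : Type*} [MeasurableSpace Ω] [AddAction (E d) Ω] [MeasurableVAdd₂ (E d) Ω]
  {P : Measure Ω} [IsProbabilityMeasure P] [VAddInvariantMeasure (E d) Ω P]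

/-! ### Divergence-free fields -/

theorem measurable_field {φ : Ω → E d} (h : ∀ i, Measurable fun ω => φ ω i) : Measurable φ :=
  (MeasurableEquiv.toLp 2 (Fin d → ℝ)).measurable.comp (measurable_pi_iff.2 h)

theorem measurable_component {φ : Ω → E d} (h : Measurable φ) (i : Fin d) :
    Measurable fun ω => φ ω i :=
  (EuclideanSpace.proj i : E d →L[ℝ] ℝ).continuous.measurable.comp h

theorem memLp_field {φ : Ω → E d} (h : ∀ i, (fun ω => φ ω i) ∈ Ds d P) : MemLp φ 2 P :=
  MemLp.of_eval_piLp fun i => (h i).1.2.1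

theorem memLp_component {φ : Ω → E d} (h : MemLp φ 2 P) (i : Fin d) :
    MemLp (fun ω => φ ω i) 2 P :=
  MemLp.eval_piLp h i

theorem integral_field_apply {φ : Ω → E d} (h : MemLp φ 2 P) (i : Fin d) :
    (∫ ω, φ ω ∂P) i = ∫ ω, φ ω i ∂P :=
  eval_integral_piLp (fun j => (memLp_component h j).integrable (by norm_num)) i

theorem mem_Phis_iff {φ : Ω → E d} {y : E d} (h : ∀ i, (fun ω => φ ω i) ∈ Ds d P) :
    φ ∈ Phis P y ↔ (∀ ω, ∑ i : Fin d, classicalPartial i (fun ω' => φ ω' i) ω = 0) ∧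
      ∀ i, ∫ ω, φ ω i ∂P = y i := by
  have h1 : ∫ ω, φ ω ∂P = y ↔ ∀ i, ∫ ω, φ ω i ∂P = y i := by
    simp only [← integral_field_apply (memLp_field h)]
    exact ⟨fun h i => h ▸ rfl, fun h => PiLp.ext h⟩
  exact ⟨fun hφ => ⟨hφ.2.1, h1.1 hφ.2.2⟩, fun hφ => ⟨h, hφ.1, h1.2 hφ.2⟩⟩

/-- Integration by parts turns the weak divergence into the pointwise one. -/
theorem Phis_subset_Phiw (y : E d) : Phis P y ⊆ Phiw P y := by
  rintro φ ⟨h1, h2, h3⟩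
  refine ⟨measurable_field fun i => (h1 i).1.1, memLp_field h1, fun w hw => ?_, h3⟩
  have hi : ∀ i : Fin d, Integrable (fun ω => classicalPartial i w ω * φ ω i) P := fun i =>
    (classicalPartial_mem_Ds hw i).1.2.1.integrable_mul (h1 i).1.2.1
  have hi' : ∀ i : Fin d, Integrable
      (fun ω => w ω * classicalPartial i (fun ω' => φ ω' i) ω) P := fun i =>
    hw.1.2.1.integrable_mul (classicalPartial_mem_Ds (h1 i) i).1.2.1
  rw [integral_finsetSum _ fun i _ => hi i]
  have h4 : ∀ i : Fin d, ∫ ω, classicalPartial i w ω * φ ω i ∂P =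
      -∫ ω, w ω * classicalPartial i (fun ω' => φ ω' i) ω ∂P := fun i =>
    integral_classicalPartial_mul hw (h1 i) i
  rw [Finset.sum_congr rfl fun i _ => h4 i, Finset.sum_neg_distrib,
    ← integral_finsetSum _ fun i _ => hi' i]
  simp only [← Finset.mul_sum, h2, mul_zero, integral_zero, neg_zero]

theorem add_mem_Phis {φ ψ : Ω → E d} {y z : E d} (hφ : φ ∈ Phis P y) (hψ : ψ ∈ Phis P z) :
    φ + ψ ∈ Phis P (y + z) := by
  have h : ∀ i, (fun ω => (φ + ψ) ω i) ∈ Ds d P := fun i => add_mem_Ds (hφ.1 i) (hψ.1 i)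
  refine (mem_Phis_iff h).2 ⟨fun ω => ?_, fun i => ?_⟩
  · have h1 : ∀ i : Fin d, classicalPartial i (fun ω' => (φ + ψ) ω' i) ω =
        classicalPartial i (fun ω' => φ ω' i) ω + classicalPartial i (fun ω' => ψ ω' i) ω :=
      fun i => congrFun (classicalPartial_add (hφ.1 i) (hψ.1 i) i) ω
    simp only [h1, Finset.sum_add_distrib, hφ.2.1, hψ.2.1, add_zero]
  · have h1 := integral_add (integrable_of_mem_Ds (hφ.1 i)) (integrable_of_mem_Ds (hψ.1 i))
    rw [((mem_Phis_iff hφ.1).1 hφ).2, ((mem_Phis_iff hψ.1).1 hψ).2] at h1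
    exact h1

theorem const_mem_Phis (y : E d) : (fun _ : Ω => y) ∈ Phis P y := by
  refine (mem_Phis_iff fun i => const_mem_Ds (y i)).2 ⟨fun ω => ?_, fun i => by simp⟩
  refine Finset.sum_eq_zero fun i _ => ?_
  rw [classicalPartial_invariant (g := fun _ : Ω => y i) (fun _ _ => rfl) i]
  rfl

theorem const_smul_mem_Phis {φ : Ω → E d} {y : E d} (hφ : φ ∈ Phis P y) (c : ℝ) :
    c • φ ∈ Phis P (c • y) := by
  have h : ∀ i, (fun ω => (c • φ) ω i) ∈ Ds d P := fun i => const_smul_mem_Ds (hφ.1 i) c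
  refine (mem_Phis_iff h).2 ⟨fun ω => ?_, fun i => ?_⟩
  · have h1 : ∀ i : Fin d, classicalPartial i (fun ω' => (c • φ) ω' i) ω =
        c * classicalPartial i (fun ω' => φ ω' i) ω :=
      fun i => congrFun (classicalPartial_const_smul (fun ω' => φ ω' i) c i) ω
    simp only [h1, ← Finset.mul_sum, hφ.2.1, mul_zero]
  · have h1 : ∫ ω, c * φ ω i ∂P = c * ∫ ω, φ ω i ∂P := integral_const_mul _ _
    rw [((mem_Phis_iff hφ.1).1 hφ).2] at h1
    exact h1

/-- The field `∂_j h e_i - ∂_i h e_j` is divergence-free. -/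
theorem curl_mem_Phis {h : Ω → ℝ} (hh : h ∈ Ds d P) (i j : Fin d) :
    (fun ω => classicalPartial j h ω • (e i : E d) - classicalPartial i h ω • e j) ∈
      Phis P (0 : E d) := by
  have hi := classicalPartial_mem_Ds hh i
  have hj := classicalPartial_mem_Ds hh j
  have hcomp : ∀ k : Fin d,
      (fun ω => (classicalPartial j h ω • (e i : E d) - classicalPartial i h ω • e j) k) =
      ((e i : E d) k) • classicalPartial j h + (-(e j : E d) k) • classicalPartial i h := by
    intro k
    ext ω
    simp only [PiLp.sub_apply, PiLp.smul_apply, smul_eq_mul, Pi.add_apply, Pi.smul_apply]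
    ring
  have hD : ∀ k : Fin d,
      (fun ω => (classicalPartial j h ω • (e i : E d) - classicalPartial i h ω • e j) k) ∈
        Ds d P := fun k => by
    rw [hcomp]
    exact add_mem_Ds (const_smul_mem_Ds hj _) (const_smul_mem_Ds hi _)
  refine (mem_Phis_iff hD).2 ⟨fun ω => ?_, fun k => ?_⟩
  · have hdiv : ∀ k : Fin d, classicalPartial k (fun ω =>
        (classicalPartial j h ω • (e i : E d) - classicalPartial i h ω • e j) k) ω =
        (e i : E d) k * classicalPartial k (classicalPartial j h) ω -
          (e j : E d) k * classicalPartial k (classicalPartial i h) ω := by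
      intro k
      rw [hcomp, classicalPartial_add (const_smul_mem_Ds hj _) (const_smul_mem_Ds hi _),
        classicalPartial_const_smul, classicalPartial_const_smul]
      simp only [Pi.add_apply, Pi.smul_apply, smul_eq_mul]
      ring
    simp only [hdiv, Finset.sum_sub_distrib, PiLp.single_apply, ite_mul, one_mul,
      zero_mul, Finset.sum_ite_eq', Finset.mem_univ, if_true]
    rw [classicalPartial_comm hh i j, sub_self]
  · rw [hcomp]
    have h1 := integral_add ((integrable_of_mem_Ds hj).const_mul ((e i : E d) k))
      ((integrable_of_mem_Ds hi).const_mul (-(e j : E d) k))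
    rw [integral_const_mul, integral_const_mul, integral_classicalPartial_eq_zero hh,
      integral_classicalPartial_eq_zero hh] at h1
    exact h1.trans (by simp)

/-- These test fields replace ergodicity: they detect components that are constant along orbits but
not on `Ω`. -/
theorem invariant_mem_Phis {g : Ω → ℝ} (hg : Measurable g) {C : ℝ} (hC : ∀ ω, |g ω| ≤ C)
    (hinv : ∀ (x : E d) (ω : Ω), g (x +ᵥ ω) = g ω) (v : E d) :
    (fun ω => (g ω - ∫ ω', g ω' ∂P) • v) ∈ Phis P (0 : E d) := by
  set c := ∫ ω', g ω' ∂P with hc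
  have hinv' : ∀ i : Fin d, ∀ (x : E d) (ω : Ω),
      ((g (x +ᵥ ω) - c) • v) i = ((g ω - c) • v) i := fun i x ω => by rw [hinv]
  have hgi : Integrable g P := Integrable.of_bound hg.aestronglyMeasurable C
    (Eventually.of_forall hC)
  have hD : ∀ i, (fun ω => ((g ω - c) • v) i) ∈ Ds d P := fun i => by
    refine invariant_mem_Ds (C := (C + |c|) * |v i|) ((hg.sub_const c).mul_const (v i))
      (fun ω => ?_) (hinv' i)
    rw [PiLp.smul_apply, smul_eq_mul, abs_mul]
    gcongr
    exact (abs_sub _ _).trans (add_le_add (hC ω) le_rfl)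
  refine (mem_Phis_iff hD).2 ⟨fun ω => Finset.sum_eq_zero fun i _ => ?_, fun i => ?_⟩
  · rw [classicalPartial_invariant (g := fun ω => ((g ω - c) • v) i) (hinv' i) i]
    rfl
  · simp only [PiLp.smul_apply, smul_eq_mul, PiLp.zero_apply]
    rw [integral_mul_const, integral_sub hgi (integrable_const c)]
    simp [hc]

/-- A weakly divergence-free mean-zero field orthogonal to `Φ_0^s` vanishes. -/
theorem ae_eq_zero_of_orthogonal_Phis {r : Ω → E d} (hr : Measurable r) (hr2 : MemLp r 2 P)
    (hdiv : ∀ w ∈ Ds d P, ∑ i : Fin d, ∫ ω, classicalPartial i w ω * r ω i ∂P = 0)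
    (hmean : ∀ i, ∫ ω, r ω i ∂P = 0)
    (horth : ∀ φ ∈ Phis P (0 : E d), ∫ ω, inner ℝ (φ ω) (r ω) ∂P = 0) : r =ᵐ[P] 0 := by
  have hri := fun i => measurable_component hr i
  have hri2 := fun i => memLp_component hr2 i
  have hcurl : ∀ h ∈ Ds d P, ∀ i j : Fin d,
      ∫ ω, classicalPartial j h ω * r ω i ∂P = ∫ ω, classicalPartial i h ω * r ω j ∂P := by
    intro h hh i j
    have h1 := horth _ (curl_mem_Phis hh i j)
    have h2 : ∀ ω, inner ℝ (classicalPartial j h ω • (e i : E d) - classicalPartial i h ω • e j)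
        (r ω) = classicalPartial j h ω * r ω i - classicalPartial i h ω * r ω j := by
      intro ω
      rw [inner_sub_left, inner_smul_left, inner_smul_left, EuclideanSpace.inner_single_left,
        EuclideanSpace.inner_single_left]
      simp
    simp only [h2] at h1
    have h3 := integral_sub ((classicalPartial_mem_Ds hh j).1.2.1.integrable_mul (hri2 i))
      ((classicalPartial_mem_Ds hh i).1.2.1.integrable_mul (hri2 j))
    simp only [Pi.mul_apply] at h3
    linarith
  have hcomp : ∀ i, ∀ᵐ ω ∂P, r ω i = 0 := by
    intro i
    -- Pairing `r_i` with `∂_j ∂_j w` equals pairing `r_j` with `∂_i ∂_j w`, by the curl relation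
    -- for `∂_j w`. Summed over `j`, this is the divergence condition tested with `∂_i w`.
    have horbit : ∀ᵐ ω ∂P, ∀ᵐ x : E d, r (x +ᵥ ω) i = r ω i := by
      refine ae_ae_eq_of_integral_laplacian_eq_zero (hri i) (hri2 i) fun w hw => ?_
      rw [← hdiv _ (classicalPartial_mem_Ds hw i)]
      refine Finset.sum_congr rfl fun j _ => ?_
      rw [hcurl _ (classicalPartial_mem_Ds hw j) i j, classicalPartial_comm hw i j]
    -- As `r_i` may be unbounded, it is tested against its arctangent: `arctan s * s` is nonnegative
    -- and vanishes only at `s = 0`.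
    have hbM : ∀ ω, |Real.arctan (r ω i)| ≤ Real.pi / 2 := fun ω =>
      abs_le.2 ⟨(Real.neg_pi_div_two_lt_arctan _).le, (Real.arctan_lt_pi_div_two _).le⟩
    obtain ⟨g, hg, ⟨C, hC⟩, hgb, hinv⟩ := exists_invariant_version (d := d) (P := P)
      (b := fun ω => Real.arctan (r ω i)) (Real.measurable_arctan.comp (hri i)) hbM (by
        filter_upwards [horbit] with ω hω
        filter_upwards [hω] with x hx
        rw [hx])
    have hint : Integrable (fun ω => Real.arctan (r ω i) * r ω i) P :=
      ((hri2 i).integrable (by norm_num)).bdd_mul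
        (Real.measurable_arctan.comp (hri i)).aestronglyMeasurable (Eventually.of_forall hbM)
    have h1 := horth _ (invariant_mem_Phis hg hC hinv (e i))
    have h2 : (fun ω => inner ℝ ((g ω - ∫ ω', g ω' ∂P) • (e i : E d)) (r ω)) =ᵐ[P]
        fun ω => Real.arctan (r ω i) * r ω i - (∫ ω', g ω' ∂P) * r ω i := by
      filter_upwards [hgb] with ω hω
      rw [inner_smul_left, EuclideanSpace.inner_single_left, hω]
      simp only [map_one, one_mul, conj_trivial]
      ring
    rw [integral_congr_ae h2, integral_sub hint (((hri2 i).integrable (by norm_num)).const_mul _),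
      integral_const_mul, hmean, mul_zero, sub_zero] at h1
    have hnn : ∀ s : ℝ, 0 ≤ Real.arctan s * s := fun s => by
      rcases le_total 0 s with hs | hs
      · exact mul_nonneg (Real.arctan_nonneg.2 hs) hs
      · exact mul_nonneg_of_nonpos_of_nonpos
          (by simpa using Real.arctan_strictMono.monotone hs) hs
    rw [integral_eq_zero_iff_of_nonneg (fun ω => hnn _) hint] at h1
    filter_upwards [h1] with ω hω
    rcases mul_eq_zero.1 hω with h | h
    · exact Real.arctan_eq_zero_iff.1 h
    · exact h
  filter_upwards [ae_all_iff.2 hcomp] with ω hω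
  exact PiLp.ext hω

/-- The classes of `Φ_0^s` in `L²`. -/
noncomputable def PhisSubmodule (P : Measure Ω) [IsProbabilityMeasure P]
    [VAddInvariantMeasure (E d) Ω P] : Submodule ℝ (Lp (E d) 2 P) where
  carrier := {F | ∃ φ ∈ Phis P (0 : E d), F =ᵐ[P] φ}
  zero_mem' := ⟨_, const_mem_Phis 0, Lp.coeFn_zero _ _ _⟩
  add_mem' := by
    rintro F G ⟨φ, hφ, hF⟩ ⟨ψ, hψ, hG⟩
    refine ⟨φ + ψ, by simpa using add_mem_Phis hφ hψ, (Lp.coeFn_add F G).trans (hF.add hG)⟩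
  smul_mem' := by
    rintro c F ⟨φ, hφ, hF⟩
    exact ⟨c • φ, by simpa using const_smul_mem_Phis hφ c,
      (Lp.coeFn_smul c F).trans (hF.const_smul c)⟩

/-- The gradient of a function with smooth realisations. -/
noncomputable def gradField (w : Ω → ℝ) (ω : Ω) : E d :=
  WithLp.toLp 2 fun i => classicalPartial i w ω

theorem memLp_gradField {w : Ω → ℝ} (hw : w ∈ Ds d P) : MemLp (gradField (d := d) w) 2 P :=
  memLp_field fun i => classicalPartial_mem_Ds hw i

theorem inner_gradField (w : Ω → ℝ) (ω : Ω) (v : E d) :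
    inner ℝ (gradField w ω) v = ∑ i : Fin d, classicalPartial i w ω * v i := by
  simp [PiLp.inner_apply, gradField, mul_comm]

theorem inner_toLp {φ ψ : Ω → E d} (hφ : MemLp φ 2 P) {F : Lp (E d) 2 P} (hF : F =ᵐ[P] ψ) :
    inner ℝ (hφ.toLp φ) F = ∫ ω, inner ℝ (φ ω) (ψ ω) ∂P := by
  rw [L2.inner_def]
  refine integral_congr_ae ?_
  filter_upwards [hφ.coeFn_toLp, hF] with ω h1 h2
  rw [h1, h2]

/-- The orthogonal remainder `z` of `ψ` is a difference of `ψ` and a limit of `Φ_0^s` fields, so it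
keeps zero mean and weak divergence zero. Being orthogonal to `Φ_0^s` as well, it vanishes. -/
theorem toLp_mem_closure_PhisSubmodule {ψ : Ω → E d} (hψ : ψ ∈ Phiw P (0 : E d)) :
    hψ.2.1.toLp ψ ∈ (PhisSubmodule (d := d) P).topologicalClosure := by
  set F := hψ.2.1.toLp ψ with hF
  set T := (PhisSubmodule (d := d) P).topologicalClosure with hT
  have : CompleteSpace T := (Submodule.isClosed_topologicalClosure _).completeSpace_coe
  obtain ⟨p, hp, z, hz, hpz⟩ := T.exists_add_mem_mem_orthogonal F
  -- `z` satisfies every closed linear condition satisfied by all of `Phiw P 0`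
  have hzero : ∀ G : Lp (E d) 2 P,
      (∀ (φ : Ω → E d) (H : Lp (E d) 2 P), φ ∈ Phiw P (0 : E d) → H =ᵐ[P] φ → inner ℝ G H = 0) →
      inner ℝ G z = 0 := by
    intro G hG
    have h1 : T ≤ (ℝ ∙ G)ᗮ := by
      refine Submodule.topologicalClosure_minimal _ ?_ (Submodule.isClosed_orthogonal _)
      rintro H ⟨φ, hφ, hHφ⟩
      exact Submodule.mem_orthogonal_singleton_iff_inner_right.2
        (hG φ H (Phis_subset_Phiw 0 hφ) hHφ)
    have h2 := Submodule.mem_orthogonal_singleton_iff_inner_right.1 (h1 hp)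
    have h3 := hG ψ F hψ hψ.2.1.coeFn_toLp
    rw [hpz, inner_add_right, h2, zero_add] at h3
    exact h3
  have hzm : AEStronglyMeasurable z P := Lp.aestronglyMeasurable z
  obtain ⟨r, hr, hzr⟩ : ∃ r : Ω → E d, Measurable r ∧ z =ᵐ[P] r :=
    ⟨hzm.mk z, hzm.stronglyMeasurable_mk.measurable, hzm.ae_eq_mk⟩
  have hr2 : MemLp r 2 P := (memLp_congr_ae hzr).1 (Lp.memLp z)
  have hr0 : r =ᵐ[P] 0 := by
    refine ae_eq_zero_of_orthogonal_Phis hr hr2 (fun w hw => ?_) (fun i => ?_) fun φ hφ => ?_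
    · have h1 := hzero ((memLp_gradField hw).toLp _) fun φ H hφ hH => by
        rw [inner_toLp _ hH]
        simp only [inner_gradField]
        exact hφ.2.2.1 w hw
      rw [inner_toLp _ hzr] at h1
      simp only [inner_gradField] at h1
      have hi : ∀ i : Fin d, Integrable (fun ω => classicalPartial i w ω * r ω i) P := fun i =>
        (classicalPartial_mem_Ds hw i).1.2.1.integrable_mul (memLp_component hr2 i)
      rwa [integral_finsetSum _ fun i _ => hi i] at h1
    · have h1 := hzero ((memLp_const (e i : E d)).toLp _) fun φ H hφ hH => by
        rw [inner_toLp _ hH]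
        simp only [EuclideanSpace.inner_single_left, map_one, one_mul]
        rw [← integral_field_apply hφ.2.1, hφ.2.2.2]
        rfl
      rw [inner_toLp _ hzr] at h1
      simpa only [EuclideanSpace.inner_single_left, map_one, one_mul] using h1
    · have h1 : (memLp_field hφ.1).toLp φ ∈ T :=
        Submodule.le_topologicalClosure _ ⟨φ, hφ, (memLp_field hφ.1).coeFn_toLp⟩
      rw [← inner_toLp (memLp_field hφ.1) hzr]
      exact (Submodule.mem_orthogonal _ _).1 hz _ h1
  have hz0 : z = 0 := Lp.ext ((hzr.trans hr0).trans (Lp.coeFn_zero _ _ _).symm)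
  rw [hpz, hz0, add_zero]
  exact hp

/-- Gradients have mean zero, so constant fields are weakly divergence-free; this reduces the
density claim to mean zero. -/
theorem sub_const_mem_Phiw {φ : Ω → E d} {y : E d} (hφ : φ ∈ Phiw P y) :
    (fun ω => φ ω - y) ∈ Phiw P (0 : E d) := by
  have hi : Integrable φ P := hφ.2.1.integrable (by norm_num)
  refine ⟨hφ.1.sub_const y, hφ.2.1.sub (memLp_const y), fun w hw => ?_, ?_⟩
  · have h1 : ∀ i : Fin d, Integrable (fun ω => classicalPartial i w ω * φ ω i) P := fun i =>
      (classicalPartial_mem_Ds hw i).1.2.1.integrable_mul (memLp_component hφ.2.1 i)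
    have h2 := fun i : Fin d => (integrable_of_mem_Ds (classicalPartial_mem_Ds hw i)).mul_const
      (y i)
    simp only [PiLp.sub_apply, mul_sub, Finset.sum_sub_distrib]
    have h3 : ∫ ω, ∑ i : Fin d, classicalPartial i w ω * y i ∂P = 0 := by
      rw [integral_finsetSum _ fun i _ => h2 i]
      refine Finset.sum_eq_zero fun i _ => ?_
      rw [integral_mul_const, integral_classicalPartial_eq_zero hw, zero_mul]
    rw [integral_sub (integrable_finsetSum _ fun i _ => h1 i)
      (integrable_finsetSum _ fun i _ => h2 i), h3, hφ.2.2.1 w hw, sub_zero]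
  · rw [integral_sub hi (integrable_const y), hφ.2.2.2]
    simp

theorem Phis_mem_frakP (y : E d) : Phis P y ∈ frakP P y := by
  refine ⟨Phis_subset_Phiw y, fun φ hφ ε hε => ?_⟩
  have hψ := sub_const_mem_Phiw hφ
  have h1 : hψ.2.1.toLp _ ∈ closure (PhisSubmodule (d := d) P : Set (Lp (E d) 2 P)) :=
    toLp_mem_closure_PhisSubmodule hψ
  obtain ⟨G, ⟨χ, hχ, hGχ⟩, hlt⟩ := EMetric.mem_closure_iff.1 h1 ε hε
  refine ⟨χ + fun _ => y, by simpa using add_mem_Phis hχ (const_mem_Phis y), ?_⟩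
  rw [edist_comm, Lp.edist_def] at hlt
  refine (eLpNorm_congr_ae ?_).trans_lt hlt
  filter_upwards [hGχ, hψ.2.1.coeFn_toLp] with ω a b
  simp only [Pi.sub_apply, Pi.add_apply, a, b]
  abel

end

end StationaryDensity

theorem lemma2p1 (d : ℕ) (hd : 1 ≤ d) {Ω : Type*} [MeasurableSpace Ω]
    [AddAction (StationaryDensity.E d) Ω] [MeasurableVAdd₂ (StationaryDensity.E d) Ω]
    (P : Measure Ω) [IsProbabilityMeasure P] [VAddInvariantMeasure (StationaryDensity.E d) Ω P] :
    Dense {F : Lp ℝ 2 P | ∃ f ∈ StationaryDensity.Ds d P, F =ᵐ[P] f} ∧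
    StationaryDensity.Ds d P ∈ StationaryDensity.frakD d P ∧
    StationaryDensity.Fs d P ∈ StationaryDensity.frakF d P ∧
    ∀ y : StationaryDensity.E d, StationaryDensity.Phis P y ∈ StationaryDensity.frakP P y :=
  ⟨StationaryDensity.dense_Ds, StationaryDensity.Ds_mem_frakD, StationaryDensity.Fs_mem_frakF,
    StationaryDensity.Phis_mem_frakP⟩
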